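/- **Setting (class of models).** Let $\mathcal S$ be a finite nonempty set, and let $c(x,y)=c(y,x)\ge 0$ ($x\ne y$) be a connectivity function such that any two states are joined by a chain of steps with $c\neq0$. Fix $\beta>0$ and $\bar E>0$. A model in the class determined by $(\mathcal S,c,\beta,\bar E)$ consists of a Hamiltonian $H^\nu_x\in\mathbb R$ ($x\in\mathcal S$) that depends smoothly on a parameter $\nu$ in a compact subset of some $\mathbb R^{n'}$ and satisfies $|H^\nu_x|\le\bar E$, a function $\xi^\kappa_{x\to y}\in\mathbb R$ ($x\ne y$, $c(x,y)\ne0$) with a parameter $\kappa$ in a compact subset of some $\mathbb R^{n''}$ and $|\xi^\kappa_{x\to y}|\le1$, and one of the two choices of equilibrium rates $R^{(\beta,\nu)}_{x\to y}=c(x,y)e^{\beta H^\nu_x}$ or $R^{(\beta,\nu)}_{x\to y}=c(x,y)e^{(\beta/2)(H^\nu_x-H^\nu_y)}$. For $\epsilon\ge0$ and $\alpha=(\beta,\epsilon,\nu,\kappa)$ the transition rates are $$R^\alpha_{x\to y}=e^{\epsilon\,\xi^\kappa_{x\to y}}R^{(\beta,\nu)}_{x\to y}\qquad(x\ne y),$$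 with escape rates $\lambda^\alpha_x=\sum_{y\ne x}R^\alpha_{x\to y}$. Let $\rho^\alpha$ be the stationary probability distribution of the Markov jump process with these rates, and put $\langle g\rangle_{\rm st}^\alpha=\sum_x g_x\rho^\alpha_x$. **Free energy and entropy.** For $R^\alpha_{x\to y}\ne0$ let $\psi^\alpha_{x\to y}=\log(R^\alpha_{x\to y}/R^\alpha_{y\to x})-\beta(H^\nu_x-H^\nu_y)$. A path on $[a,b]$ is given by states $x_0,\dots,x_n$ with $x_{j-1}\ne x_j$ and jump times $a=t_0<t_1<\dots<t_n<t_{n+1}=b$ ($n\ge0$). It has the weight $\prod_{j=1}^nR^\alpha_{x_{j-1}\to x_j}\prod_{j=0}^ne^{-\lambda^\alpha_{x_j}(t_{j+1}-t_j)}$, and $\Psi=\sum_{j=1}^n\psi^\alpha_{x_{j-1}\to x_j}$. Let $\langle f\rangle^{[a,b]}_{x\to}$ be the integral of $f$ times the weight over all paths on $[a,b]$ with $x_0=x$ (summing over $n$ and over the states, integrating over the jump times), and let $[f]^{[a,b]}_{{\rm st}\to x}$ be the integral of $f$ times $\rho^\alpha_{x_0}$ times the weight over all paths with $x_n=x$.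 The nonequilibrium free energy $F(\alpha)$ is defined by $$e^{-\beta F(\alpha)}=e^{-\beta H^\nu_x}\lim_{\tau\to\infty}\frac{\langle e^{-\Psi/2}\rangle^{[-\tau,-\tau/2]}_{x\to}}{[e^{-\Psi/2}]^{[\tau/2,\tau]}_{{\rm st}\to x}},$$ the nonequilibrium entropy is $S(\alpha)=\beta(\langle H^\nu\rangle^\alpha_{\rm st}-F(\alpha))$, and the Shannon entropy is $S_{\rm Sh}[p]=-\sum_xp_x\log p_x$. **Theorem (nonequilibrium entropy and the Shannon entropy).** There is a constant $A>0$, depending only on the class of models (that is, on $\mathcal S,c,\beta,\bar E$), such that for every model in the class and every $\alpha=(\beta,\epsilon,\nu,\kappa)$ with $\epsilon\ge0$ and $\nu,\kappa$ in their ranges, the stationary distribution $\rho^\alpha$ exists and is unique, the limit defining $F(\alpha)$ exists, is positive and does not depend on $x$ (so that $F(\alpha)$ is well defined), and $$\bigl|S(\alpha)-S_{\rm Sh}[\rho^\alpha]\bigr|\le A\,\epsilon^3 .$$ -/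

import Mathlib

open Filter Topology MeasureTheory
open scoped ContDiff

namespace NESS

noncomputable section

/-! ### Markov jump processes on a finite state space

Transition rates are given by `R : S → S → ℝ`, where `R x y` (for `x ≠ y`) is the rate of the
jump from `x` to `y`. The diagonal values `R x x` are never used. -/

/-- The escape rate `λ_x = ∑_{y ≠ x} R_{x → y}`. -/
def escapeRate {S : Type*} [Fintype S] [DecidableEq S] (R : S → S → ℝ) (x : S) : ℝ :=
  ∑ y ∈ Finset.univ.filter (fun y => y ≠ x), R x y

/-- The transition rate matrix acting on column vectors: its `(y, x)` entry is `R_{x → y}` for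
`x ≠ y`, and `-λ_x` for `x = y`. -/
def rateMatrix {S : Type*} [Fintype S] [DecidableEq S] (R : S → S → ℝ) : Matrix S S ℝ :=
  Matrix.of fun y x => if y = x then -escapeRate R x else R x y

/-- `ρ` is a stationary probability distribution. -/
def IsStationaryDistribution {S : Type*} [Fintype S] [DecidableEq S]
    (R : S → S → ℝ) (ρ : S → ℝ) : Prop :=
  (∀ x, 0 ≤ ρ x) ∧ ∑ x, ρ x = 1 ∧ (rateMatrix R).mulVec ρ = 0

/-- The entropy production in the baths, `θ_{x → y} = log (R_{x → y} / R_{y → x})`. -/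
def entropyProduction {S : Type*} (R : S → S → ℝ) (x y : S) : ℝ :=
  Real.log (R x y / R y x)

/-- The nonequilibrium part `ψ_{x → y}` of the entropy production, defined by
`θ_{x → y} = ψ_{x → y} + β (H_x - H_y)`. -/
def noneqEntropyProduction {S : Type*} (R : S → S → ℝ) (β : ℝ) (H : S → ℝ) (x y : S) : ℝ :=
  entropyProduction R x y - β * (H x - H y)

/-! ### Paths

A path on the time interval `[a, b]` with `n` jumps is given by the visited states
`x_0, …, x_n` (consecutive ones being different) and the jump times `a < t_1 < ⋯ < t_n < b`. -/

/-- The times `t_0 = a, t_1, …, t_n, t_{n+1} = b`. -/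
def pathTimes {n : ℕ} (a b : ℝ) (t : Fin n → ℝ) : Fin (n + 2) → ℝ :=
  Fin.snoc (α := fun _ => ℝ) (Fin.cons (α := fun _ => ℝ) a t) b

/-- The possible sequences of jump times of a path with `n` jumps on `[a, b]`. -/
def jumpTimes (a b : ℝ) (n : ℕ) : Set (Fin n → ℝ) :=
  {t | StrictMono t ∧ ∀ j, a < t j ∧ t j < b}

/-- The possible sequences of states of a path with `n` jumps. -/
def stateSequences (S : Type*) [Fintype S] [DecidableEq S] (n : ℕ) : Finset (Fin (n + 1) → S) :=
  Finset.univ.filter fun x => ∀ j : Fin n, x j.castSucc ≠ x j.succ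

/-- The transition probability density of a path on `[a, b]` in the process with constant
transition rates `R`:
`∏_{j=1}^n R_{x_{j-1} → x_j} ∏_{j=0}^n exp (-λ_{x_j} (t_{j+1} - t_j))`. -/
def pathWeight {S : Type*} [Fintype S] [DecidableEq S] (R : S → S → ℝ) (a b : ℝ)
    {n : ℕ} (x : Fin (n + 1) → S) (t : Fin n → ℝ) : ℝ :=
  (∏ j : Fin n, R (x j.castSucc) (x j.succ)) *
    ∏ j : Fin (n + 1),
      Real.exp (-(escapeRate R (x j) * (pathTimes a b t j.succ - pathTimes a b t j.castSucc)))

/-- The integral over all paths on `[a, b]`. -/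
def pathIntegral {S : Type*} [Fintype S] [DecidableEq S] (a b : ℝ)
    (f : (n : ℕ) → (Fin (n + 1) → S) → (Fin n → ℝ) → ℝ) : ℝ :=
  ∑' n : ℕ, ∑ x ∈ stateSequences S n, ∫ t in jumpTimes a b n, f n x t

/-- The expectation `⟨f⟩_{x →}` over paths on `[a, b]` that start at the state `x₀`. -/
def expectationFrom {S : Type*} [Fintype S] [DecidableEq S] (R : S → S → ℝ) (a b : ℝ) (x₀ : S)
    (f : (n : ℕ) → (Fin (n + 1) → S) → (Fin n → ℝ) → ℝ) : ℝ :=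
  pathIntegral a b fun n x t =>
    f n x t * (if x 0 = x₀ then 1 else 0) * pathWeight R a b x t

/-- The unnormalized expectation `[f]_{st → y}` over paths on `[a, b]` that start in the
distribution `ρ` and end at the state `y₀`. -/
def expectationStTo {S : Type*} [Fintype S] [DecidableEq S] (R : S → S → ℝ) (ρ : S → ℝ)
    (a b : ℝ) (y₀ : S) (f : (n : ℕ) → (Fin (n + 1) → S) → (Fin n → ℝ) → ℝ) : ℝ :=
  pathIntegral a b fun n x t =>
    f n x t * ρ (x 0) * (if x (Fin.last n) = y₀ then 1 else 0) * pathWeight R a b x t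

/-- The path functional `Ψ = ∑_{j=1}^n ψ_{x_{j-1} → x_j}`. -/
def pathNoneqEntropyProduction {S : Type*} (R : S → S → ℝ) (β : ℝ) (H : S → ℝ)
    (n : ℕ) (x : Fin (n + 1) → S) : ℝ :=
  ∑ j : Fin n, noneqEntropyProduction R β H (x j.castSucc) (x j.succ)

/-! ### Free energy and entropy -/

/-- `F` is the nonequilibrium free energy, that is, for every state `x`,
`e^{-β F} = e^{-β H_x} lim_{τ → ∞} ⟨e^{-Ψ/2}⟩_{x →}^{[-τ, -τ/2]} / [e^{-Ψ/2}]_{st → x}^{[τ/2, τ]}`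
where the limit exists. Here `ρ` is the stationary distribution of the rates `R`. -/
def IsFreeEnergy {S : Type*} [Fintype S] [DecidableEq S] (R : S → S → ℝ) (ρ : S → ℝ)
    (β : ℝ) (H : S → ℝ) (F : ℝ) : Prop :=
  ∀ x : S, Tendsto
    (fun τ : ℝ => Real.exp (-(β * H x)) *
      (expectationFrom R (-τ) (-(τ / 2)) x
          (fun n y _ => Real.exp (-(pathNoneqEntropyProduction R β H n y / 2))) /
        expectationStTo R ρ (τ / 2) τ x
          (fun n y _ => Real.exp (-(pathNoneqEntropyProduction R β H n y / 2)))))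
    atTop (𝓝 (Real.exp (-(β * F))))

/-- The expectation `⟨g⟩_st = ∑_x g_x ρ_x`. -/
def steadyExpectation {S : Type*} [Fintype S] (ρ g : S → ℝ) : ℝ := ∑ x, g x * ρ x

/-- The nonequilibrium entropy `S = β (⟨H⟩_st - F)`. -/
def noneqEntropy {S : Type*} [Fintype S] (β : ℝ) (H ρ : S → ℝ) (F : ℝ) : ℝ :=
  β * (steadyExpectation ρ H - F)

/-- The Shannon entropy `-∑_x p_x log p_x`. -/
def shannonEntropy {S : Type*} [Fintype S] (p : S → ℝ) : ℝ := -∑ x, p x * Real.log (p x)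

/-! ### The class of models -/

/-- The data shared by all models of a class: the connectivity function `c`, the reference
inverse temperature `β`, and the bound `Ebar` on the energies. -/
structure ModelClass (S : Type*) where
  c : S → S → ℝ
  c_symm : ∀ x y, x ≠ y → c x y = c y x
  c_nonneg : ∀ x y, x ≠ y → 0 ≤ c x y
  connected : ∀ x y, Relation.ReflTransGen (fun u v => u ≠ v ∧ c u v ≠ 0) x y
  β : ℝ
  β_pos : 0 < β
  Ebar : ℝ
  Ebar_pos : 0 < Ebar

/-- The two choices of the equilibrium transition rates. -/
inductive RateRule where
  | exponential
  | symmetric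

/-- The equilibrium transition rates `c(x,y) e^{β H_x}` or `c(x,y) e^{(β/2)(H_x - H_y)}`. -/
def eqRate {S : Type*} (rule : RateRule) (c : S → S → ℝ) (β : ℝ) (H : S → ℝ) (x y : S) : ℝ :=
  match rule with
  | RateRule.exponential => c x y * Real.exp (β * H x)
  | RateRule.symmetric => c x y * Real.exp (β / 2 * (H x - H y))

/-- A model in the class `C`: a Hamiltonian `H^ν_x` depending smoothly on a parameter `ν` in a
compact set `N` and a nonequilibrium function `ξ^κ_{x → y}` with a parameter `κ` in a compact
set `K`, subject to the bounds `|H^ν_x| ≤ Ebar` and `|ξ^κ_{x → y}| ≤ 1`. -/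
structure Model {S : Type*} (C : ModelClass S) where
  rule : RateRule
  dimν : ℕ
  dimκ : ℕ
  N : Set (EuclideanSpace ℝ (Fin dimν))
  N_compact : IsCompact N
  K : Set (EuclideanSpace ℝ (Fin dimκ))
  K_compact : IsCompact K
  H : EuclideanSpace ℝ (Fin dimν) → S → ℝ
  H_smooth : ∀ x, ContDiffOn ℝ ∞ (fun ν => H ν x) N
  H_bound : ∀ ν ∈ N, ∀ x, |H ν x| ≤ C.Ebar
  ξ : EuclideanSpace ℝ (Fin dimκ) → S → S → ℝ
  ξ_bound : ∀ κ ∈ K, ∀ x y, x ≠ y → C.c x y ≠ 0 → |ξ κ x y| ≤ 1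

/-- The transition rates `R^α_{x → y} = e^{ε ξ^κ_{x → y}} R^{(β,ν)}_{x → y}`,
`α = (β, ε, ν, κ)`. -/
def Model.rate {S : Type*} {C : ModelClass S} (M : Model C) (ε : ℝ)
    (ν : EuclideanSpace ℝ (Fin M.dimν)) (κ : EuclideanSpace ℝ (Fin M.dimκ)) (x y : S) : ℝ :=
  Real.exp (ε * M.ξ κ x y) * eqRate M.rule C.c C.β (M.H ν) x y

end

end NESS

/-! Integrating over the jump times turns the path expectations of `e^{-Ψ/2}` into the Dyson series
of the tilted generator, with off-diagonal entries `e^{-ψ/2} R` and diagonal `-λ`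
(`hasSum_jumpSum`). The definition of `ψ` gives `e^{-ψ/2} R_{x → y} = √(R_{x → y} R_{y → x}) w_x /
w_y` with `w = e^{βH/2}`, so this generator is conjugate to a symmetric irreducible matrix. By
Perron–Frobenius the latter has a simple top eigenvalue `μ` with a positive eigenvector `e`. The
common growth factor cancels in the quotient defining `F`, as does the dependence on `x`, and
`e^{-βF} = (∑ e/w) / (∑ ρ w e)` (`tendsto_freeEnergy`).

Write `γ = w⁻²` for the Boltzmann weights, `p = ρ/γ`, and `v = e w / ∑ (e/w)`, so that `∑ γ p = ∑ γ
v = 1`. Then `S - S_Sh = ∑ γ p log p - log ∑ γ p v` (`noneqEntropy_sub_shannonEntropy_eq`). With `Z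
= ∑ γ`, `a = Z p - 1` and `b = Z v - 1`, of mean zero for `γ/Z`, this is the mean of `a (a - 2b) /
2` up to cubic terms (`abs_relative_entropy_sub_log_le`). Both `a` and `b` are `O(ε)`. To first
order `a = 2b`: the antisymmetric part of `ξ` alone drives both responses, entering the eigenvector
equation with half the strength it has in the stationarity equation, while `μ = O(ε²)`. Hence `2v -
p` has a Laplacian of order `ε²`, and a Poincaré inequality makes it constant up to `O(ε²)`
(`abs_two_mul_v_sub_p_le`). The difference is therefore `O(ε³)` for small `ε`.

For `ε` bounded away from zero it suffices that the difference grows at most linearly in `ε`, which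
follows from a Harnack inequality for `v` (`exists_harnack`). All constants come from `c` and from
bounds on the conductances and Boltzmann weights common to the whole class. -/

namespace NESS

noncomputable section

/-! ### Integrals over ordered jump times, split at the first jump -/

/-- The factor `∏_j exp (-l_j (t_{j+1} - t_j))` of a path weight. -/
def holdingWeight {n : ℕ} (l : Fin (n + 1) → ℝ) (a b : ℝ) (t : Fin n → ℝ) : ℝ :=
  ∏ j : Fin (n + 1),
    Real.exp (-(l j * (pathTimes a b t j.succ - pathTimes a b t j.castSucc)))

/-- The integral of `holdingWeight` over all jump times. -/
def holdingIntegral {n : ℕ} (l : Fin (n + 1) → ℝ) (a b : ℝ) : ℝ :=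
  ∫ t in jumpTimes a b n, holdingWeight l a b t

lemma pathTimes_zero {n : ℕ} (a b : ℝ) (t : Fin n → ℝ) : pathTimes a b t 0 = a := by
  have h : (0 : Fin (n + 2)) = Fin.castSucc (0 : Fin (n + 1)) := rfl
  rw [pathTimes, h, Fin.snoc_castSucc, Fin.cons_zero]

lemma pathTimes_cons_succ {n : ℕ} (a b s : ℝ) (t : Fin n → ℝ) (j : Fin (n + 2)) :
    pathTimes a b (Fin.cons s t : Fin (n + 1) → ℝ) j.succ = pathTimes s b t j := by
  refine Fin.lastCases ?_ (fun i => ?_) j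
  · rw [Fin.succ_last, pathTimes, pathTimes, Fin.snoc_last, Fin.snoc_last]
  · rw [Fin.succ_castSucc, pathTimes, pathTimes, Fin.snoc_castSucc, Fin.snoc_castSucc,
      Fin.cons_succ]

lemma holdingWeight_cons {n : ℕ} (l₀ : ℝ) (l : Fin (n + 1) → ℝ) (a b s : ℝ) (t : Fin n → ℝ) :
    holdingWeight (Fin.cons l₀ l : Fin (n + 2) → ℝ) a b (Fin.cons s t : Fin (n + 1) → ℝ) =
      Real.exp (-(l₀ * (s - a))) * holdingWeight l s b t := by
  unfold holdingWeight
  rw [Fin.prod_univ_succ]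
  congr 1
  refine Finset.prod_congr rfl fun j _ => ?_
  rw [Fin.cons_succ, pathTimes_cons_succ, ← Fin.succ_castSucc, pathTimes_cons_succ]

lemma cons_mem_jumpTimes {n : ℕ} (a b s : ℝ) (t : Fin n → ℝ) :
    (Fin.cons s t : Fin (n + 1) → ℝ) ∈ jumpTimes a b (n + 1) ↔
      s ∈ Set.Ioo a b ∧ t ∈ jumpTimes s b n := by
  simp only [jumpTimes, Set.mem_ofPred_eq, Set.mem_Ioo]
  constructor
  · rintro ⟨hm, h⟩
    refine ⟨by simpa using h 0, fun i j hij => ?_, fun j => ⟨?_, by simpa using (h j.succ).2⟩⟩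
    · simpa using hm (Fin.succ_lt_succ_iff.2 hij)
    · simpa using hm (Fin.succ_pos j)
  · rintro ⟨hs, hm, h⟩
    refine ⟨fun i j hij => ?_, fun j => ?_⟩
    · induction j using Fin.cases with
      | zero => exact absurd hij (Fin.not_lt_zero i)
      | succ j =>
        induction i using Fin.cases with
        | zero => simpa using (h j).1
        | succ i => simpa using hm (Fin.succ_lt_succ_iff.1 hij)
    · induction j using Fin.cases with
      | zero => simpa using hs
      | succ j => simpa using ⟨hs.1.trans (h j).1, (h j).2⟩

lemma measurableSet_jumpTimes (a b : ℝ) (n : ℕ) : MeasurableSet (jumpTimes a b n) := by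
  have : jumpTimes a b n = (⋂ (i : Fin n) (j : Fin n) (_ : i < j), {t | t i < t j}) ∩
      ⋂ j : Fin n, ({t | a < t j} ∩ {t | t j < b}) := by
    ext t
    simp [jumpTimes, StrictMono]
  rw [this]
  refine MeasurableSet.inter ?_ ?_
  · refine MeasurableSet.iInter fun i => MeasurableSet.iInter fun j => MeasurableSet.iInter fun _ =>
      measurableSet_lt (measurable_pi_apply i) (measurable_pi_apply j)
  · exact MeasurableSet.iInter fun j =>
      (measurableSet_lt measurable_const (measurable_pi_apply j)).inter
        (measurableSet_lt (measurable_pi_apply j) measurable_const)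

lemma continuous_pathTimes {n : ℕ} (a b : ℝ) (j : Fin (n + 2)) :
    Continuous fun t : Fin n → ℝ => pathTimes a b t j := by
  refine Fin.lastCases ?_ (fun i => ?_) j
  · simp only [pathTimes, Fin.snoc_last]
    exact continuous_const
  · simp only [pathTimes, Fin.snoc_castSucc]
    refine Fin.cases ?_ (fun k => ?_) i
    · simp only [Fin.cons_zero]
      exact continuous_const
    · simp only [Fin.cons_succ]
      exact continuous_apply k

lemma continuous_holdingWeight {n : ℕ} (l : Fin (n + 1) → ℝ) (a b : ℝ) :
    Continuous (holdingWeight l a b) := by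
  unfold holdingWeight
  have := fun j => continuous_pathTimes (n := n) a b j
  fun_prop

lemma integrableOn_holdingWeight {n : ℕ} (l : Fin (n + 1) → ℝ) (a b : ℝ) :
    IntegrableOn (holdingWeight l a b) (jumpTimes a b n) := by
  refine IntegrableOn.mono_set (t := Set.Icc (fun _ => a) (fun _ => b)) ?_ ?_
  · exact (continuous_holdingWeight l a b).continuousOn.integrableOn_compact isCompact_Icc
  · intro t ht
    exact ⟨fun j => (ht.2 j).1.le, fun j => (ht.2 j).2.le⟩

/-- Without jumps the domain is the one-point space of functions on `Fin 0`, which has mass one; no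
order between `a` and `b` is needed. -/
lemma holdingIntegral_zero (l : Fin 1 → ℝ) (a b : ℝ) :
    holdingIntegral l a b = Real.exp (-(l 0 * (b - a))) := by
  have h1 : jumpTimes a b 0 = Set.univ := by
    ext t
    simp only [jumpTimes, Set.mem_ofPred_eq, Set.mem_univ, iff_true]
    exact ⟨fun i => i.elim0, fun i => i.elim0⟩
  have h2 : ∀ t : Fin 0 → ℝ, holdingWeight l a b t = Real.exp (-(l 0 * (b - a))) := by
    intro t
    simp only [holdingWeight, Fin.prod_univ_succ, Fin.prod_univ_zero, mul_one, Fin.castSucc_zero,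
      pathTimes_zero]
    rw [show (Fin.succ (0 : Fin 1)) = Fin.last 1 from rfl, pathTimes, Fin.snoc_last]
  rw [holdingIntegral, h1]
  simp [h2, Measure.real, volume_pi]

/-- The integrand over `jumpTimes` in the coordinates (first jump, remaining jumps). -/
lemma indicator_cons {n : ℕ} (l₀ : ℝ) (l : Fin (n + 1) → ℝ) (a b s : ℝ) (t : Fin n → ℝ) :
    (jumpTimes a b (n + 1)).indicator (holdingWeight (Fin.cons l₀ l : Fin (n + 2) → ℝ) a b)
        (Fin.cons s t : Fin (n + 1) → ℝ) =
      (Set.Ioo a b).indicator (fun s => Real.exp (-(l₀ * (s - a))) *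
        (jumpTimes s b n).indicator (holdingWeight l s b) t) s := by
  by_cases hs : s ∈ Set.Ioo a b
  · by_cases ht : t ∈ jumpTimes s b n
    · rw [Set.indicator_of_mem ((cons_mem_jumpTimes a b s t).2 ⟨hs, ht⟩),
        Set.indicator_of_mem hs, Set.indicator_of_mem ht, holdingWeight_cons]
    · rw [Set.indicator_of_notMem fun h => ht ((cons_mem_jumpTimes a b s t).1 h).2,
        Set.indicator_of_mem hs, Set.indicator_of_notMem ht, mul_zero]
  · rw [Set.indicator_of_notMem fun h => hs ((cons_mem_jumpTimes a b s t).1 h).1,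
      Set.indicator_of_notMem hs]

lemma integrable_first_jump {n : ℕ} (l₀ : ℝ) (l : Fin (n + 1) → ℝ) (a b : ℝ) :
    Integrable (fun z : ℝ × (Fin n → ℝ) =>
      (jumpTimes a b (n + 1)).indicator (holdingWeight (Fin.cons l₀ l : Fin (n + 2) → ℝ) a b)
        (Fin.cons z.1 z.2 : Fin (n + 1) → ℝ)) := by
  have hmp := (volume_preserving_piFinSuccAbove (fun _ : Fin (n + 1) => ℝ) 0).symm
  have h := (integrableOn_holdingWeight (Fin.cons l₀ l : Fin (n + 2) → ℝ) a b).integrable_indicator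
    (measurableSet_jumpTimes a b (n + 1))
  have h3 := (hmp.integrable_comp_emb (MeasurableEquiv.measurableEmbedding _)).2 h
  refine h3.congr (Eventually.of_forall fun z => ?_)
  simp [MeasurableEquiv.piFinSuccAbove, Fin.consEquiv]

lemma integral_indicator_first_jump {n : ℕ} (l₀ : ℝ) (l : Fin (n + 1) → ℝ) (a b s : ℝ) :
    ∫ t, (jumpTimes a b (n + 1)).indicator (holdingWeight (Fin.cons l₀ l : Fin (n + 2) → ℝ) a b)
        (Fin.cons s t : Fin (n + 1) → ℝ) =
      (Set.Ioo a b).indicator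
        (fun s => Real.exp (-(l₀ * (s - a))) * holdingIntegral l s b) s := by
  simp_rw [indicator_cons]
  by_cases hs : s ∈ Set.Ioo a b
  · simp_rw [Set.indicator_of_mem hs]
    rw [integral_const_mul, integral_indicator (measurableSet_jumpTimes s b n), holdingIntegral]
  · simp_rw [Set.indicator_of_notMem hs]
    simp

lemma integrableOn_first_jump {n : ℕ} (l₀ : ℝ) (l : Fin (n + 1) → ℝ) (a b : ℝ) :
    IntegrableOn (fun s => Real.exp (-(l₀ * (s - a))) * holdingIntegral l s b) (Set.Ioo a b) := by
  rw [← integrable_indicator_iff measurableSet_Ioo]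
  exact (integrable_first_jump l₀ l a b).integral_prod_left.congr
    (Eventually.of_forall fun s => integral_indicator_first_jump l₀ l a b s)

lemma integrableOn_holdingIntegral {n : ℕ} (l : Fin (n + 1) → ℝ) (a b : ℝ) :
    IntegrableOn (fun s => holdingIntegral l s b) (Set.Ioo a b) := by
  simpa using integrableOn_first_jump 0 l a b

/-- Renewal at the first jump: once it happens at time `s`, the remaining jumps form a path on `[s,
b]`. The identity is Fubini in the coordinates (first jump, remaining jumps). -/
lemma holdingIntegral_cons {n : ℕ} (l₀ : ℝ) (l : Fin (n + 1) → ℝ) (a b : ℝ) :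
    holdingIntegral (Fin.cons l₀ l : Fin (n + 2) → ℝ) a b =
      ∫ s in Set.Ioo a b, Real.exp (-(l₀ * (s - a))) * holdingIntegral l s b := by
  have hmp := (volume_preserving_piFinSuccAbove (fun _ : Fin (n + 1) => ℝ) 0).symm
  rw [holdingIntegral, ← integral_indicator (measurableSet_jumpTimes a b (n + 1)),
    ← hmp.integral_comp (MeasurableEquiv.measurableEmbedding _)]
  have : ∀ z : ℝ × (Fin n → ℝ),
      (MeasurableEquiv.piFinSuccAbove (fun _ : Fin (n + 1) => ℝ) 0).symm z =
        (Fin.cons z.1 z.2 : Fin (n + 1) → ℝ) := by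
    intro z
    simp [MeasurableEquiv.piFinSuccAbove, Fin.consEquiv]
  simp_rw [this]
  rw [Measure.volume_eq_prod, integral_prod _ (integrable_first_jump l₀ l a b),
    ← integral_indicator measurableSet_Ioo]
  simp_rw [integral_indicator_first_jump]

lemma holdingIntegral_nonneg {n : ℕ} (l : Fin (n + 1) → ℝ) (a b : ℝ) :
    0 ≤ holdingIntegral l a b :=
  integral_nonneg fun _ => Finset.prod_nonneg fun _ _ => (Real.exp_pos _).le

/-! ### The Dyson series of the backward equation -/

/-- The integral over the jump times of the weight of the state sequence `x`, with jump kernel `q`,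
escape rates `l` and terminal value `φ`. -/
def sequenceWeight {S : Type*} (q : S → S → ℝ) (l φ : S → ℝ) (a b : ℝ) {n : ℕ}
    (x : Fin (n + 1) → S) : ℝ :=
  φ (x (Fin.last n)) * (∏ j : Fin n, q (x j.castSucc) (x j.succ)) *
    holdingIntegral (fun j => l (x j)) a b

/-- The contribution of the paths with `n` jumps that start at `x₀`. -/
def jumpSum {S : Type*} [Fintype S] (q : S → S → ℝ) (l φ : S → ℝ) (n : ℕ) (a b : ℝ) (x₀ : S) : ℝ :=
  ∑ x : Fin n → S, sequenceWeight q l φ a b (Fin.cons x₀ x : Fin (n + 1) → S)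

lemma sum_fin_cons {S : Type*} [Fintype S] {n : ℕ} (f : (Fin (n + 1) → S) → ℝ) :
    ∑ x, f x = ∑ y, ∑ x : Fin n → S, f (Fin.cons y x : Fin (n + 1) → S) := by
  rw [← Equiv.sum_comp (Fin.consEquiv fun _ : Fin (n + 1) => S), Fintype.sum_prod_type]
  rfl

lemma sequenceWeight_cons {S : Type*} (q : S → S → ℝ) (l φ : S → ℝ) (a b : ℝ) {n : ℕ} (x₀ : S)
    (x : Fin (n + 1) → S) :
    sequenceWeight q l φ a b (Fin.cons x₀ x : Fin (n + 2) → S) =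
      ∫ s in Set.Ioo a b, Real.exp (-(l x₀ * (s - a))) *
        (q x₀ (x 0) * sequenceWeight q l φ s b x) := by
  have h1 : (fun j => l ((Fin.cons x₀ x : Fin (n + 2) → S) j)) =
      (Fin.cons (l x₀) (fun j => l (x j)) : Fin (n + 2) → ℝ) := by
    ext j
    refine Fin.cases rfl (fun i => rfl) j
  have h2 : (Fin.cons x₀ x : Fin (n + 2) → S) (Fin.last (n + 1)) = x (Fin.last n) := by
    rw [← Fin.succ_last, Fin.cons_succ]
  have h3 : ∏ j : Fin (n + 1), q ((Fin.cons x₀ x : Fin (n + 2) → S) j.castSucc)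
      ((Fin.cons x₀ x : Fin (n + 2) → S) j.succ) =
      q x₀ (x 0) * ∏ j : Fin n, q (x j.castSucc) (x j.succ) := by
    rw [Fin.prod_univ_succ]
    rfl
  unfold sequenceWeight
  rw [h1, h2, h3, holdingIntegral_cons, ← integral_const_mul]
  refine integral_congr_ae (Eventually.of_forall fun s => ?_)
  ring

lemma integrableOn_sequenceWeight {S : Type*} (q : S → S → ℝ) (l φ : S → ℝ) (a b : ℝ) {n : ℕ}
    (x : Fin (n + 1) → S) :
    IntegrableOn (fun s => sequenceWeight q l φ s b x) (Set.Ioo a b) :=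
  (integrableOn_holdingIntegral _ a b).const_mul _

lemma integrableOn_jumpSum {S : Type*} [Fintype S] (q : S → S → ℝ) (l φ : S → ℝ) (n : ℕ)
    (a b : ℝ) (x₀ : S) : IntegrableOn (fun s => jumpSum q l φ n s b x₀) (Set.Ioo a b) :=
  integrable_finsetSum _ fun _ _ => integrableOn_sequenceWeight q l φ a b _

lemma integrableOn_exp_mul {f : ℝ → ℝ} {a b : ℝ} (r : ℝ) (hf : IntegrableOn f (Set.Ioo a b)) :
    IntegrableOn (fun s => Real.exp (-(r * (s - a))) * f s) (Set.Ioo a b) := by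
  have hc : Continuous fun s : ℝ => Real.exp (-(r * (s - a))) := by fun_prop
  obtain ⟨C, hC⟩ := (isCompact_Icc (a := a) (b := b)).exists_bound_of_continuousOn hc.continuousOn
  refine hf.bdd_mul (c := C) hc.aestronglyMeasurable ?_
  filter_upwards [ae_restrict_mem measurableSet_Ioo] with s hs
  exact hC s ⟨hs.1.le, hs.2.le⟩

lemma jumpSum_zero {S : Type*} [Fintype S] (q : S → S → ℝ) (l φ : S → ℝ) (a b : ℝ) (x₀ : S) :
    jumpSum q l φ 0 a b x₀ = Real.exp (-(l x₀ * (b - a))) * φ x₀ := by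
  simp [jumpSum, sequenceWeight, holdingIntegral_zero, mul_comm]

lemma jumpSum_succ {S : Type*} [Fintype S] (q : S → S → ℝ) (l φ : S → ℝ) (n : ℕ) (a b : ℝ)
    (x₀ : S) :
    jumpSum q l φ (n + 1) a b x₀ =
      ∫ s in Set.Ioo a b, Real.exp (-(l x₀ * (s - a))) *
        ∑ y, q x₀ y * jumpSum q l φ n s b y := by
  rw [jumpSum, sum_fin_cons]
  simp_rw [sequenceWeight_cons, Fin.cons_zero]
  have hi : ∀ (y : S) (x : Fin n → S), IntegrableOn (fun s => Real.exp (-(l x₀ * (s - a))) *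
      (q x₀ y * sequenceWeight q l φ s b (Fin.cons y x : Fin (n + 1) → S))) (Set.Ioo a b) :=
    fun y x => integrableOn_exp_mul _ ((integrableOn_sequenceWeight q l φ a b _).const_mul _)
  simp_rw [Finset.mul_sum, jumpSum, Finset.mul_sum]
  rw [integral_finsetSum _ fun y _ => integrable_finsetSum _ fun x _ => hi y x]
  refine Finset.sum_congr rfl fun y _ => ?_
  rw [integral_finsetSum _ fun x _ => hi y x]

lemma jumpSum_nonneg {S : Type*} [Fintype S] {q : S → S → ℝ} {l φ : S → ℝ} (hq : ∀ x y, 0 ≤ q x y)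
    (hφ : ∀ x, 0 ≤ φ x) (n : ℕ) (a b : ℝ) (x₀ : S) : 0 ≤ jumpSum q l φ n a b x₀ :=
  Finset.sum_nonneg fun _ _ => mul_nonneg (mul_nonneg (hφ _)
    (Finset.prod_nonneg fun _ _ => hq _ _)) (holdingIntegral_nonneg _ _ _)

/-- Duhamel's formula for the backward equation. -/
lemma duhamel {S : Type*} [Fintype S] {q : S → S → ℝ} {l : S → ℝ} {V : ℝ → S → ℝ}
    (hV : ∀ t x, HasDerivAt (fun t => V t x) (∑ y, q x y * V t y - l x * V t x) t)
    {a b : ℝ} (hab : a ≤ b) (x : S) :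
    V (b - a) x = Real.exp (-(l x * (b - a))) * V 0 x +
      ∫ s in Set.Ioo a b, Real.exp (-(l x * (s - a))) * ∑ y, q x y * V (b - s) y := by
  -- The integrating factor cancels the escape term of the backward equation and leaves only the
  -- jump term.
  have hd : ∀ s, HasDerivAt (fun s => -(Real.exp (-(l x * (s - a))) * V (b - s) x))
      (Real.exp (-(l x * (s - a))) * ∑ y, q x y * V (b - s) y) s := by
    intro s
    have h1 : HasDerivAt (fun s => Real.exp (-(l x * (s - a))))
        (Real.exp (-(l x * (s - a))) * (-(l x * 1))) s :=
      ((((hasDerivAt_id s).sub_const a).const_mul (l x)).neg).exp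
    have h2 : HasDerivAt (fun s => V (b - s) x)
        ((∑ y, q x y * V (b - s) y - l x * V (b - s) x) * (-1)) s :=
      (hV (b - s) x).comp s ((hasDerivAt_id s).const_sub b)
    refine (h1.mul h2).neg.congr_deriv ?_
    ring
  have hc : Continuous fun s => Real.exp (-(l x * (s - a))) * ∑ y, q x y * V (b - s) y := by
    have : ∀ y, Continuous fun t => V t y := fun y =>
      continuous_iff_continuousAt.2 fun t => (hV t y).continuousAt
    have : ∀ y, Continuous fun s => V (b - s) y := fun y => (this y).comp (by fun_prop)
    fun_prop
  rw [← integral_Ioc_eq_integral_Ioo, ← intervalIntegral.integral_of_le hab,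
    intervalIntegral.integral_eq_sub_of_hasDerivAt (fun s _ => hd s) (hc.intervalIntegrable _ _)]
  simp

/-- The remainder of the Dyson series after `N` terms. -/
def dysonRemainder {S : Type*} [Fintype S] (q : S → S → ℝ) (l φ : S → ℝ) (V : ℝ → S → ℝ) (b : ℝ)
    (N : ℕ) (a : ℝ) (x : S) : ℝ :=
  V (b - a) x - ∑ n ∈ Finset.range N, jumpSum q l φ n a b x

/-- Duhamel's formula for `V` and the renewal equation for `jumpSum` have the same integral kernel,
and their zero-jump terms cancel. -/
lemma dysonRemainder_succ {S : Type*} [Fintype S] {q : S → S → ℝ} {l φ : S → ℝ} {V : ℝ → S → ℝ}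
    (hV : ∀ t x, HasDerivAt (fun t => V t x) (∑ y, q x y * V t y - l x * V t x) t)
    (hφ : ∀ x, V 0 x = φ x) {a b : ℝ} (hab : a ≤ b) (N : ℕ) (x : S) :
    dysonRemainder q l φ V b (N + 1) a x =
      ∫ s in Set.Ioo a b, Real.exp (-(l x * (s - a))) *
        ∑ y, q x y * dysonRemainder q l φ V b N s y := by
  have hVc : ∀ x, Continuous fun t => V t x := fun y =>
      continuous_iff_continuousAt.2 fun t => (hV t y).continuousAt
  have hiV : IntegrableOn (fun s => Real.exp (-(l x * (s - a))) * ∑ y, q x y * V (b - s) y)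
      (Set.Ioo a b) := by
    refine integrableOn_exp_mul _ (integrable_finsetSum _ fun y _ => Integrable.const_mul ?_ _)
    have hc : Continuous fun s => V (b - s) y := (hVc y).comp (by fun_prop)
    exact (hc.continuousOn.integrableOn_compact isCompact_Icc).mono_set Set.Ioo_subset_Icc_self
  have hiJ : ∀ n, IntegrableOn (fun s => Real.exp (-(l x * (s - a))) *
      ∑ y, q x y * jumpSum q l φ n s b y) (Set.Ioo a b) := fun n =>
    integrableOn_exp_mul _ (integrable_finsetSum _ fun y _ =>
      (integrableOn_jumpSum q l φ n a b y).const_mul _)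
  rw [dysonRemainder, Finset.sum_range_succ', jumpSum_zero, duhamel hV hab x, hφ]
  simp_rw [jumpSum_succ]
  rw [← integral_finsetSum _ fun n _ => hiJ n, add_comm (∫ s in _, _), add_sub_add_left_eq_sub,
    ← integral_sub hiV (integrable_finsetSum _ fun n _ => hiJ n)]
  refine integral_congr_ae (Eventually.of_forall fun s => ?_)
  simp only [dysonRemainder, mul_sub, Finset.sum_sub_distrib, Finset.mul_sum]
  congr 1
  rw [Finset.sum_comm]

/-- Each application of the recursion bounds the exponential by one, costs a factor `Q`, and
integrates once more in time; this produces the factorial. -/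
lemma abs_dysonRemainder_le {S : Type*} [Fintype S] {q : S → S → ℝ} {l φ : S → ℝ} {V : ℝ → S → ℝ}
    (hV : ∀ t x, HasDerivAt (fun t => V t x) (∑ y, q x y * V t y - l x * V t x) t)
    (hφ : ∀ x, V 0 x = φ x) (hq : ∀ x y, 0 ≤ q x y) (hl : ∀ x, 0 ≤ l x) {Q C a b : ℝ}
    (hQ : ∀ x, ∑ y, q x y ≤ Q) (hQ0 : 0 ≤ Q) (hC0 : 0 ≤ C)
    (hC : ∀ s ∈ Set.Icc a b, ∀ x, |V (b - s) x| ≤ C) (N : ℕ) :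
    ∀ s ∈ Set.Icc a b, ∀ x, |dysonRemainder q l φ V b N s x| ≤
      C * ((Q * (b - s)) ^ N / N.factorial) := by
  induction N with
  | zero => simpa [dysonRemainder] using hC
  | succ N ih =>
    intro s hs x
    have hd : ∀ u, HasDerivAt
        (fun u => -(C * ((Q * (b - u)) ^ (N + 1) / (N + 1).factorial)))
        (Q * (C * ((Q * (b - u)) ^ N / N.factorial))) u := by
      intro u
      have h1 : HasDerivAt (fun u : ℝ => Q * (b - u)) (Q * (-1)) u :=
        ((hasDerivAt_id u).const_sub b).const_mul Q
      have h2 := (((h1.pow (N + 1)).div_const ((N + 1).factorial : ℝ)).const_mul C).neg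
      refine h2.congr_deriv ?_
      rw [Nat.factorial_succ]
      push_cast
      have : ((N : ℝ) + 1) ≠ 0 := by positivity
      have : (N.factorial : ℝ) ≠ 0 := by positivity
      field_simp
    have hc : Continuous fun u : ℝ => Q * (C * ((Q * (b - u)) ^ N / N.factorial)) := by fun_prop
    rw [dysonRemainder_succ hV hφ hs.2 N x, ← integral_Ioc_eq_integral_Ioo,
      ← intervalIntegral.integral_of_le hs.2]
    have hval : ∫ u in s..b, Q * (C * ((Q * (b - u)) ^ N / N.factorial)) =
        C * ((Q * (b - s)) ^ (N + 1) / (N + 1).factorial) := by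
      rw [intervalIntegral.integral_eq_sub_of_hasDerivAt (fun u _ => hd u)
        (hc.intervalIntegrable _ _)]
      simp
    rw [← hval, ← Real.norm_eq_abs]
    refine intervalIntegral.norm_integral_le_of_norm_le hs.2 ?_ (hc.intervalIntegrable _ _)
    refine Eventually.of_forall fun u hu => ?_
    have hu' : u ∈ Set.Icc a b := ⟨hs.1.trans hu.1.le, hu.2⟩
    rw [Real.norm_eq_abs, abs_mul, abs_of_pos (Real.exp_pos _)]
    have h1 : Real.exp (-(l x * (u - s))) ≤ 1 :=
      Real.exp_le_one_iff.2 (neg_nonpos.2 (mul_nonneg (hl x) (sub_nonneg.2 hu.1.le)))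
    have hB : 0 ≤ C * ((Q * (b - u)) ^ N / N.factorial) := by
      have : 0 ≤ b - u := sub_nonneg.2 hu.2
      positivity
    have h2 : |∑ y, q x y * dysonRemainder q l φ V b N u y| ≤
        Q * (C * ((Q * (b - u)) ^ N / N.factorial)) := by
      refine (Finset.abs_sum_le_sum_abs _ _).trans ?_
      refine le_trans (Finset.sum_le_sum fun y _ => ?_)
        ((Finset.sum_mul _ _ _).symm.trans_le (mul_le_mul_of_nonneg_right (hQ x) hB))
      rw [abs_mul, abs_of_nonneg (hq x y)]
      exact mul_le_mul_of_nonneg_left (ih u hu' y) (hq x y)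
    calc _ ≤ 1 * |∑ y, q x y * dysonRemainder q l φ V b N u y| :=
          mul_le_mul_of_nonneg_right h1 (abs_nonneg _)
      _ ≤ _ := by rwa [one_mul]

/-- The Dyson series converges to the solution of the backward equation. -/
theorem hasSum_jumpSum {S : Type*} [Fintype S] {q : S → S → ℝ} {l φ : S → ℝ} {V : ℝ → S → ℝ}
    (hV : ∀ t x, HasDerivAt (fun t => V t x) (∑ y, q x y * V t y - l x * V t x) t)
    (hV0 : ∀ x, V 0 x = φ x) (hφ : ∀ x, 0 ≤ φ x) (hq : ∀ x y, 0 ≤ q x y) (hl : ∀ x, 0 ≤ l x)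
    {a b : ℝ} (hab : a ≤ b) (x : S) :
    HasSum (fun n => jumpSum q l φ n a b x) (V (b - a) x) := by
  have hVc : ∀ x, Continuous fun t => V t x := fun y =>
    continuous_iff_continuousAt.2 fun t => (hV t y).continuousAt
  have hVc' : Continuous fun s => ∑ y, |V (b - s) y| :=
    continuous_finsetSum _ fun y _ => ((hVc y).comp (by fun_prop : Continuous fun s => b - s)).abs
  obtain ⟨C, hC⟩ := (isCompact_Icc (a := a) (b := b)).exists_bound_of_continuousOn
    hVc'.continuousOn
  have hC' : ∀ s ∈ Set.Icc a b, ∀ x, |V (b - s) x| ≤ C := fun s hs y =>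
    (Finset.single_le_sum (f := fun y => |V (b - s) y|) (fun _ _ => abs_nonneg _)
      (Finset.mem_univ y)).trans ((le_abs_self _).trans (hC s hs))
  have hC0 : 0 ≤ C := (abs_nonneg _).trans (hC' a ⟨le_rfl, hab⟩ x)
  have hQ : ∀ x, ∑ y, q x y ≤ ∑ x, ∑ y, q x y := fun x =>
    Finset.single_le_sum (f := fun x => ∑ y, q x y)
      (fun _ _ => Finset.sum_nonneg fun _ _ => hq _ _) (Finset.mem_univ x)
  have hQ0 : 0 ≤ ∑ x, ∑ y, q x y :=
    Finset.sum_nonneg fun _ _ => Finset.sum_nonneg fun _ _ => hq _ _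
  -- All terms are nonnegative, so convergence of the partial sums already gives summability.
  rw [hasSum_iff_tendsto_nat_of_nonneg fun n => jumpSum_nonneg hq hφ n a b x]
  have hb := fun N => abs_dysonRemainder_le hV hV0 hq hl hQ hQ0 hC0 hC' N a ⟨le_rfl, hab⟩ x
  have hz : Tendsto (fun N => dysonRemainder q l φ V b N a x) atTop (𝓝 0) := by
    refine squeeze_zero_norm hb ?_
    simpa using (FloorSemiring.tendsto_pow_div_factorial_atTop
      ((∑ x, ∑ y, q x y) * (b - a))).const_mul C
  have h := hz.const_sub (V (b - a) x)
  simpa [dysonRemainder] using h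

/-! ### Path expectations and the tilted generator -/

/-- The off-diagonal part of the tilted generator, `e^{-ψ_{x → y} / 2} R_{x → y}`. -/
def tiltedRate {S : Type*} [DecidableEq S] (R : S → S → ℝ) (β : ℝ) (H : S → ℝ) (x y : S) : ℝ :=
  if x = y then 0 else Real.exp (-(noneqEntropyProduction R β H x y / 2)) * R x y

lemma prod_tiltedRate_of_mem {S : Type*} [Fintype S] [DecidableEq S] (R : S → S → ℝ) (β : ℝ)
    (H : S → ℝ) {n : ℕ} {x : Fin (n + 1) → S} (hx : x ∈ stateSequences S n) :
    ∏ j : Fin n, tiltedRate R β H (x j.castSucc) (x j.succ) =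
      Real.exp (-(pathNoneqEntropyProduction R β H n x / 2)) *
        ∏ j : Fin n, R (x j.castSucc) (x j.succ) := by
  have h : ∀ j : Fin n, x j.castSucc ≠ x j.succ := (Finset.mem_filter.1 hx).2
  simp_rw [tiltedRate, if_neg (h _)]
  rw [Finset.prod_mul_distrib, ← Real.exp_sum, pathNoneqEntropyProduction, Finset.sum_div,
    Finset.sum_neg_distrib]

lemma prod_tiltedRate_of_notMem {S : Type*} [Fintype S] [DecidableEq S] (R : S → S → ℝ) (β : ℝ)
    (H : S → ℝ) {n : ℕ} {x : Fin (n + 1) → S} (hx : x ∉ stateSequences S n) :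
    ∏ j : Fin n, tiltedRate R β H (x j.castSucc) (x j.succ) = 0 := by
  have : ∃ j : Fin n, x j.castSucc = x j.succ := by
    by_contra h
    push Not at h
    exact hx (Finset.mem_filter.2 ⟨Finset.mem_univ _, h⟩)
  obtain ⟨j, hj⟩ := this
  exact Finset.prod_eq_zero (Finset.mem_univ j) (if_pos hj)

lemma sum_stateSequences_integral {S : Type*} [Fintype S] [DecidableEq S] (R : S → S → ℝ) (β : ℝ)
    (H : S → ℝ) (a b : ℝ) (n : ℕ) (g : (Fin (n + 1) → S) → ℝ) :
    ∑ x ∈ stateSequences S n, ∫ t in jumpTimes a b n,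
      Real.exp (-(pathNoneqEntropyProduction R β H n x / 2)) * g x * pathWeight R a b x t =
    ∑ x : Fin (n + 1) → S, g x * (∏ j : Fin n, tiltedRate R β H (x j.castSucc) (x j.succ)) *
      holdingIntegral (fun j => escapeRate R (x j)) a b := by
  -- The kernel vanishes on the diagonal, so sequences with a repeated state may be added to the sum
  -- for free.
  rw [← Finset.sum_subset (Finset.subset_univ (stateSequences S n))]
  · refine Finset.sum_congr rfl fun x hx => ?_
    rw [prod_tiltedRate_of_mem R β H hx, holdingIntegral, ← integral_const_mul]
    refine integral_congr_ae (Eventually.of_forall fun t => ?_)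
    simp only [pathWeight, holdingWeight]
    ring
  · intro x _ hx
    rw [prod_tiltedRate_of_notMem R β H hx, mul_zero, zero_mul]

lemma expectationFrom_eq {S : Type*} [Fintype S] [DecidableEq S] (R : S → S → ℝ) (β : ℝ)
    (H : S → ℝ) (a b : ℝ) (x₀ : S) :
    expectationFrom R a b x₀
        (fun n y _ => Real.exp (-(pathNoneqEntropyProduction R β H n y / 2))) =
      ∑' n, jumpSum (tiltedRate R β H) (escapeRate R) (fun _ => 1) n a b x₀ := by
  unfold expectationFrom pathIntegral
  refine tsum_congr fun n => ?_
  rw [sum_stateSequences_integral R β H a b n fun x => if x 0 = x₀ then 1 else 0, sum_fin_cons,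
    Finset.sum_eq_single x₀]
  · simp [jumpSum, sequenceWeight]
  · intro y _ hy
    simp [hy]
  · simp

lemma expectationStTo_eq {S : Type*} [Fintype S] [DecidableEq S] (R : S → S → ℝ) (ρ : S → ℝ)
    (β : ℝ) (H : S → ℝ) (a b : ℝ) (y₀ : S) :
    expectationStTo R ρ a b y₀
        (fun n y _ => Real.exp (-(pathNoneqEntropyProduction R β H n y / 2))) =
      ∑' n, ∑ z, ρ z *
        jumpSum (tiltedRate R β H) (escapeRate R) (fun y => if y = y₀ then 1 else 0) n a b z := by
  unfold expectationStTo pathIntegral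
  refine tsum_congr fun n => ?_
  have h := sum_stateSequences_integral R β H a b n
    fun x => ρ (x 0) * (if x (Fin.last n) = y₀ then 1 else 0)
  simp_rw [← mul_assoc] at h
  rw [h, sum_fin_cons]
  refine Finset.sum_congr rfl fun z _ => ?_
  rw [jumpSum, Finset.mul_sum]
  refine Finset.sum_congr rfl fun x _ => ?_
  simp only [sequenceWeight, Fin.cons_zero]
  ring

lemma escapeRate_nonneg {S : Type*} [Fintype S] [DecidableEq S] {R : S → S → ℝ}
    (hR : ∀ x y, x ≠ y → 0 ≤ R x y) (x : S) : 0 ≤ escapeRate R x :=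
  Finset.sum_nonneg fun y hy => hR x y (Finset.mem_filter.1 hy).2.symm

lemma tiltedRate_nonneg {S : Type*} [DecidableEq S] {R : S → S → ℝ} (β : ℝ) (H : S → ℝ)
    (hR : ∀ x y, x ≠ y → 0 ≤ R x y) (x y : S) : 0 ≤ tiltedRate R β H x y := by
  unfold tiltedRate
  split_ifs with h
  · exact le_rfl
  · exact mul_nonneg (Real.exp_pos _).le (hR x y h)

/-- `V` is the semigroup of the tilted generator: `V φ t` solves the backward equation with initial
value `φ`. -/
def IsTiltedSemigroup {S : Type*} [Fintype S] [DecidableEq S] (R : S → S → ℝ) (β : ℝ) (H : S → ℝ)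
    (V : (S → ℝ) → ℝ → S → ℝ) : Prop :=
  ∀ φ, (∀ t x, HasDerivAt (fun t => V φ t x)
    (∑ y, tiltedRate R β H x y * V φ t y - escapeRate R x * V φ t x) t) ∧ ∀ x, V φ 0 x = φ x

lemma IsTiltedSemigroup.expectationFrom_eq {S : Type*} [Fintype S] [DecidableEq S]
    {R : S → S → ℝ} {β : ℝ} {H : S → ℝ} {V : (S → ℝ) → ℝ → S → ℝ} (hV : IsTiltedSemigroup R β H V)
    (hR : ∀ x y, x ≠ y → 0 ≤ R x y) {a b : ℝ} (hab : a ≤ b) (x₀ : S) :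
    expectationFrom R a b x₀
        (fun n y _ => Real.exp (-(pathNoneqEntropyProduction R β H n y / 2))) =
      V (fun _ => 1) (b - a) x₀ := by
  rw [NESS.expectationFrom_eq]
  exact (hasSum_jumpSum (hV _).1 (hV _).2 (fun _ => zero_le_one) (tiltedRate_nonneg β H hR)
    (escapeRate_nonneg hR) hab x₀).tsum_eq

lemma IsTiltedSemigroup.expectationStTo_eq {S : Type*} [Fintype S] [DecidableEq S]
    {R : S → S → ℝ} {β : ℝ} {H : S → ℝ} {V : (S → ℝ) → ℝ → S → ℝ} (hV : IsTiltedSemigroup R β H V)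
    (hR : ∀ x y, x ≠ y → 0 ≤ R x y) (ρ : S → ℝ) {a b : ℝ} (hab : a ≤ b) (y₀ : S) :
    expectationStTo R ρ a b y₀
        (fun n y _ => Real.exp (-(pathNoneqEntropyProduction R β H n y / 2))) =
      ∑ z, ρ z * V (fun y => if y = y₀ then 1 else 0) (b - a) z := by
  rw [NESS.expectationStTo_eq]
  refine HasSum.tsum_eq (hasSum_sum fun z _ => HasSum.mul_left _ ?_)
  exact hasSum_jumpSum (hV _).1 (hV _).2 (fun y => by split_ifs <;> norm_num)
    (tiltedRate_nonneg β H hR) (escapeRate_nonneg hR) hab z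

/-! ### Spectral theorem and Perron–Frobenius for symmetric matrices -/

/-- `e i` is an orthonormal eigenbasis of `G` with eigenvalues `μ i`. -/
structure IsEigenbasis {S : Type*} [Fintype S] [DecidableEq S] (G : S → S → ℝ) (e : S → S → ℝ)
    (μ : S → ℝ) : Prop where
  eigen : ∀ i x, ∑ y, G x y * e i y = μ i * e i x
  orthonormal : ∀ i j, ∑ x, e i x * e j x = if i = j then 1 else 0
  complete : ∀ x y, ∑ i, e i x * e i y = if x = y then 1 else 0

lemma exists_isEigenbasis {S : Type*} [Fintype S] [DecidableEq S] {G : S → S → ℝ}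
    (hG : ∀ x y, G x y = G y x) : ∃ e μ, IsEigenbasis G e μ := by
  have hA : (Matrix.of G).IsHermitian := by
    ext x y
    simp [hG x y]
  have hU : (hA.eigenvectorUnitary : Matrix S S ℝ) * star (hA.eigenvectorUnitary : Matrix S S ℝ) =
      1 := Unitary.coe_mul_star_self _
  have hU' : star (hA.eigenvectorUnitary : Matrix S S ℝ) * (hA.eigenvectorUnitary : Matrix S S ℝ) =
      1 := Unitary.coe_star_mul_self _
  refine ⟨fun i x => hA.eigenvectorBasis i x, hA.eigenvalues, ⟨fun i x => ?_, fun i j => ?_,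
    fun x y => ?_⟩⟩
  · simpa [Matrix.mulVec, dotProduct] using congrFun (hA.mulVec_eigenvectorBasis i) x
  · have := congrFun (congrFun hU' i) j
    simpa [Matrix.mul_apply, Matrix.one_apply] using this
  · have := congrFun (congrFun hU x) y
    simpa [Matrix.mul_apply, Matrix.one_apply] using this

namespace IsEigenbasis

variable {S : Type*} [Fintype S] [DecidableEq S] {G : S → S → ℝ} {e : S → S → ℝ} {μ : S → ℝ}

/-- The coefficients of `f` in the eigenbasis. -/
lemma expand (h : IsEigenbasis G e μ) (f : S → ℝ) (x : S) :
    ∑ i, (∑ y, e i y * f y) * e i x = f x := by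
  simp_rw [Finset.sum_mul]
  rw [Finset.sum_comm]
  have : ∀ y, ∑ i, e i y * f y * e i x = if y = x then f y else 0 := fun y => by
    have h1 := h.complete y x
    calc _ = f y * ∑ i, e i y * e i x := by
          rw [Finset.mul_sum]; exact Finset.sum_congr rfl fun _ _ => by ring
      _ = _ := by rw [h1]; split_ifs <;> simp
  simp [this]

lemma apply_eq (h : IsEigenbasis G e μ) (f : S → ℝ) (x : S) :
    ∑ y, G x y * f y = ∑ i, μ i * (∑ y, e i y * f y) * e i x := by
  calc ∑ y, G x y * f y = ∑ y, G x y * ∑ i, (∑ y, e i y * f y) * e i y := by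
        simp_rw [h.expand f]
    _ = ∑ i, (∑ y, e i y * f y) * ∑ y, G x y * e i y := by
        simp_rw [Finset.mul_sum]
        rw [Finset.sum_comm]
        exact Finset.sum_congr rfl fun _ _ => Finset.sum_congr rfl fun _ _ => by ring
    _ = _ := by
        simp_rw [h.eigen]
        exact Finset.sum_congr rfl fun _ _ => by ring

lemma quadratic_eq (h : IsEigenbasis G e μ) (f : S → ℝ) :
    ∑ x, f x * ∑ y, G x y * f y = ∑ i, μ i * (∑ y, e i y * f y) ^ 2 := by
  simp_rw [h.apply_eq f]
  rw [Finset.sum_congr rfl fun x _ => Finset.mul_sum _ _ (f x), Finset.sum_comm]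
  refine Finset.sum_congr rfl fun i _ => ?_
  calc _ = μ i * (∑ y, e i y * f y) * ∑ x, e i x * f x := by
        rw [Finset.mul_sum _ _ (μ i * ∑ y, e i y * f y)]
        exact Finset.sum_congr rfl fun _ _ => by ring
    _ = _ := by ring

lemma norm_eq (h : IsEigenbasis G e μ) (f : S → ℝ) :
    ∑ x, f x ^ 2 = ∑ i, (∑ y, e i y * f y) ^ 2 := by
  calc ∑ x, f x ^ 2 = ∑ x, f x * ∑ i, (∑ y, e i y * f y) * e i x := by
        simp_rw [h.expand f, sq]
    _ = _ := by
        simp_rw [Finset.mul_sum]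
        rw [Finset.sum_comm]
        refine Finset.sum_congr rfl fun i _ => ?_
        rw [sq, Finset.mul_sum]
        exact Finset.sum_congr rfl fun _ _ => by ring

lemma quadratic_le (h : IsEigenbasis G e μ) {m : ℝ} (hm : ∀ i, μ i ≤ m) (f : S → ℝ) :
    ∑ x, f x * ∑ y, G x y * f y ≤ m * ∑ x, f x ^ 2 := by
  rw [h.quadratic_eq, h.norm_eq, Finset.mul_sum]
  exact Finset.sum_le_sum fun i _ => mul_le_mul_of_nonneg_right (hm i) (sq_nonneg _)

/-- In eigencoordinates the defect `m ‖f‖² - ⟨f, G f⟩` is the sum of the nonnegative terms `(m - μ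
i) c_i²`. If it is not positive, only coefficients with `μ i = m` survive. -/
lemma eigen_of_quadratic_ge (h : IsEigenbasis G e μ) {m : ℝ} (hm : ∀ i, μ i ≤ m) {f : S → ℝ}
    (hf : m * ∑ x, f x ^ 2 ≤ ∑ x, f x * ∑ y, G x y * f y) (x : S) :
    ∑ y, G x y * f y = m * f x := by
  rw [h.quadratic_eq, h.norm_eq, Finset.mul_sum, ← sub_nonpos, ← Finset.sum_sub_distrib] at hf
  have hn : ∀ i, 0 ≤ m * (∑ y, e i y * f y) ^ 2 - μ i * (∑ y, e i y * f y) ^ 2 := fun i =>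
    sub_nonneg.2 (mul_le_mul_of_nonneg_right (hm i) (sq_nonneg _))
  have hz := (Finset.sum_eq_zero_iff_of_nonneg fun i _ => hn i).1
    (le_antisymm hf (Finset.sum_nonneg fun i _ => hn i))
  rw [h.apply_eq, ← h.expand f x, Finset.mul_sum]
  refine Finset.sum_congr rfl fun i hi => ?_
  have h1 := hz i hi
  rw [← sub_mul, mul_eq_zero] at h1
  rcases h1 with h1 | h1
  · rw [← sub_eq_zero.1 h1]; ring
  · rw [pow_eq_zero_iff two_ne_zero] at h1
    rw [h1]; ring

end IsEigenbasis

/-- A nonnegative eigenvector of an irreducible matrix with nonnegative off-diagonal entries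
vanishes identically or nowhere. -/
lemma eq_zero_of_eigen_of_nonneg {S : Type*} [Fintype S] {G : S → S → ℝ}
    (hG : ∀ x y, x ≠ y → 0 ≤ G x y)
    (hc : ∀ x y, Relation.ReflTransGen (fun u v => u ≠ v ∧ G u v ≠ 0) x y) {f : S → ℝ} {m : ℝ}
    (hf : ∀ x, 0 ≤ f x) (he : ∀ x, ∑ y, G x y * f y = m * f x) {x₀ : S} (h0 : f x₀ = 0) (x : S) :
    f x = 0 := by
  induction hc x₀ x with
  | refl => exact h0
  | tail _ huv ih =>
    rename_i u v _
    have h1 := he u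
    rw [ih, mul_zero] at h1
    -- At a zero `u` of `f` the diagonal term drops out whatever its sign, so a vanishing sum of
    -- nonnegative terms forces `f` to vanish at every neighbour of `u`.
    have h2 : ∀ y ∈ Finset.univ, 0 ≤ G u y * f y := fun y _ => by
      by_cases hy : u = y
      · rw [← hy, ih, mul_zero]
      · exact mul_nonneg (hG u y hy) (hf y)
    exact (mul_eq_zero.1 ((Finset.sum_eq_zero_iff_of_nonneg h2).1 h1 v (Finset.mem_univ v))
      ).resolve_left huv.2

/-- The Perron–Frobenius theorem for symmetric matrices. -/
theorem exists_perron_eigenbasis {S : Type*} [Fintype S] [DecidableEq S] [Nonempty S]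
    {G : S → S → ℝ} (hs : ∀ x y, G x y = G y x) (hG : ∀ x y, x ≠ y → 0 ≤ G x y)
    (hc : ∀ x y, Relation.ReflTransGen (fun u v => u ≠ v ∧ G u v ≠ 0) x y) :
    ∃ e μ i₀, IsEigenbasis G e μ ∧ (∀ i, i ≠ i₀ → μ i < μ i₀) ∧ ∀ x, 0 < e i₀ x := by
  obtain ⟨e, μ, h⟩ := exists_isEigenbasis hs
  obtain ⟨i₀, hi₀⟩ := Finite.exists_max μ
  -- Taking absolute values keeps the norm and does not lower the quadratic form, since the
  -- off-diagonal entries are nonnegative. So the absolute value of a top eigenvector again attains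
  -- the maximum.
  have habs : ∀ i, μ i = μ i₀ → ∀ x, ∑ y, G x y * |e i y| = μ i₀ * |e i x| := by
    intro i hi
    refine h.eigen_of_quadratic_ge hi₀ ?_
    have h1 : ∑ x, e i x * ∑ y, G x y * e i y = μ i₀ * ∑ x, |e i x| ^ 2 := by
      simp_rw [h.eigen, hi, sq_abs, Finset.mul_sum]
      exact Finset.sum_congr rfl fun _ _ => by ring
    rw [← h1]
    refine Finset.sum_le_sum fun x _ => ?_
    rw [Finset.mul_sum, Finset.mul_sum]
    refine Finset.sum_le_sum fun y _ => ?_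
    by_cases hxy : x = y
    · subst hxy
      have := abs_mul_abs_self (e i x)
      exact le_of_eq (by linear_combination (-G x x) * this)
    · have h2 : e i x * e i y ≤ |e i x| * |e i y| := by
        rw [← abs_mul]; exact le_abs_self _
      have := mul_le_mul_of_nonneg_left h2 (hG x y hxy)
      linarith
  have hne : ∀ i, ¬ ∀ x, e i x = 0 := fun i hz => by
    have := h.orthonormal i i
    simp [hz] at this
  have hsign : ∀ i, μ i = μ i₀ → (∀ x, 0 < e i x) ∨ ∀ x, e i x < 0 := by
    intro i hi
    -- With `s` the sign of `e i` at one state, `|e i| - s e i` is a nonnegative eigenvector with a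
    -- zero, hence zero; and `|e i|` has no zero because `e i` is not identically zero.
    have key : ∀ s : ℝ, ∀ x₀, |e i x₀| = s * e i x₀ → (∀ x, s * e i x ≤ |e i x|) →
        ∀ x, 0 < s * e i x := by
      intro s x₀ hx₀ hle
      have hz : ∀ x, |e i x| - s * e i x = 0 :=
        eq_zero_of_eigen_of_nonneg hG hc (m := μ i₀) (fun x => sub_nonneg.2 (hle x))
          (fun x => by
            simp_rw [mul_sub, Finset.sum_sub_distrib, habs i hi x]
            have := h.eigen i x
            rw [hi] at this
            congr 1
            calc _ = s * ∑ y, G x y * e i y := by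
                  rw [Finset.mul_sum]; exact Finset.sum_congr rfl fun _ _ => by ring
              _ = _ := by rw [this]; ring) (sub_eq_zero.2 hx₀)
      intro x
      rw [← sub_eq_zero.1 (hz x), abs_pos]
      intro hx
      exact hne i fun y => abs_eq_zero.1 (eq_zero_of_eigen_of_nonneg hG hc
        (f := fun x => |e i x|) (fun _ => abs_nonneg _) (habs i hi) (abs_eq_zero.2 hx) y)
    obtain ⟨x₀⟩ := ‹Nonempty S›
    rcases le_total 0 (e i x₀) with h0 | h0
    · left
      simpa using key 1 x₀ (by rw [abs_of_nonneg h0, one_mul]) fun x => by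
        rw [one_mul]; exact le_abs_self _
    · right
      have := key (-1) x₀ (by rw [abs_of_nonpos h0, neg_one_mul]) fun x => by
        rw [neg_one_mul]; exact neg_le_abs _
      intro x
      have := this x
      linarith
  have hlt : ∀ i, i ≠ i₀ → μ i < μ i₀ := by
    intro i hi
    refine lt_of_le_of_ne (hi₀ i) fun heq => ?_
    have ho := h.orthonormal i i₀
    rw [if_neg hi] at ho
    -- Two vectors of constant sign cannot be orthogonal, so the top eigenvalue is simple.
    have hp : ∀ s t : ℝ, (∀ x, 0 < s * e i x) → (∀ x, 0 < t * e i₀ x) → False := by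
      intro s t h1 h2
      have h3 : 0 < ∑ x, (s * e i x) * (t * e i₀ x) :=
        Finset.sum_pos (fun x _ => mul_pos (h1 x) (h2 x)) Finset.univ_nonempty
      have h4 : ∑ x, (s * e i x) * (t * e i₀ x) = s * t * ∑ x, e i x * e i₀ x := by
        rw [Finset.mul_sum]; exact Finset.sum_congr rfl fun _ _ => by ring
      rw [h4, ho, mul_zero] at h3
      exact lt_irrefl _ h3
    have hs' : ∀ i, μ i = μ i₀ → ∃ s : ℝ, ∀ x, 0 < s * e i x := by
      intro i hi
      rcases hsign i hi with h1 | h1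
      · exact ⟨1, by simpa using h1⟩
      · exact ⟨-1, by simpa using h1⟩
    obtain ⟨s, hs1⟩ := hs' i heq
    obtain ⟨t, ht1⟩ := hs' i₀ rfl
    exact hp s t hs1 ht1
  rcases hsign i₀ rfl with hp | hn
  · exact ⟨e, μ, i₀, h, hlt, hp⟩
  · refine ⟨fun i x => -e i x, μ, i₀, ⟨fun i x => ?_, fun i j => ?_, fun x y => ?_⟩, hlt,
      fun x => neg_pos.2 (hn x)⟩
    · simpa using h.eigen i x
    · simpa using h.orthonormal i j
    · simpa using h.complete x y

/-! ### Symmetrization and the limit defining the free energy -/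

/-- The symmetrized generator, which is similar to the tilted generator. -/
def symmetrizedRate {S : Type*} [Fintype S] [DecidableEq S] (R : S → S → ℝ) (x y : S) : ℝ :=
  if x = y then -escapeRate R x else Real.sqrt (R x y * R y x)

/-- Nonnegative irreducible rates such that every jump can be reversed. -/
structure IsReversibleSupport {S : Type*} (R : S → S → ℝ) : Prop where
  nonneg : ∀ x y, x ≠ y → 0 ≤ R x y
  symm : ∀ x y, x ≠ y → R x y ≠ 0 → R y x ≠ 0
  connected : ∀ x y, Relation.ReflTransGen (fun u v => u ≠ v ∧ R u v ≠ 0) x y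

section FreeEnergy

variable {S : Type*} [Fintype S] [DecidableEq S] {R : S → S → ℝ}

lemma symmetrizedRate_symm (R : S → S → ℝ) (x y : S) :
    symmetrizedRate R x y = symmetrizedRate R y x := by
  unfold symmetrizedRate
  by_cases h : x = y
  · subst h; rfl
  · rw [if_neg h, if_neg (Ne.symm h), mul_comm]

lemma symmetrizedRate_nonneg (R : S → S → ℝ) (x y : S) (h : x ≠ y) :
    0 ≤ symmetrizedRate R x y := by
  rw [symmetrizedRate, if_neg h]
  exact Real.sqrt_nonneg _

lemma IsReversibleSupport.symmetrizedRate_connected (hR : IsReversibleSupport R) (x y : S) :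
    Relation.ReflTransGen (fun u v => u ≠ v ∧ symmetrizedRate R u v ≠ 0) x y := by
  refine Relation.ReflTransGen.mono (fun u v h => ?_) x y (hR.connected x y)
  refine ⟨h.1, ?_⟩
  rw [symmetrizedRate, if_neg h.1]
  have h1 := lt_of_le_of_ne (hR.nonneg u v h.1) h.2.symm
  have h2 := lt_of_le_of_ne (hR.nonneg v u h.1.symm) (hR.symm u v h.1 h.2).symm
  exact (Real.sqrt_pos.2 (mul_pos h1 h2)).ne'

/-- Half of the entropy production turns `R x y` into the geometric mean of the two opposite rates;
the energy part of `ψ` remains as a conjugation by `e^{βH/2}`. -/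
lemma IsReversibleSupport.tiltedRate_eq (hR : IsReversibleSupport R) (β : ℝ) (H : S → ℝ)
    {x y : S} (h : x ≠ y) :
    tiltedRate R β H x y =
      symmetrizedRate R x y * (Real.exp (β * H x / 2) / Real.exp (β * H y / 2)) := by
  rw [tiltedRate, if_neg h, symmetrizedRate, if_neg h]
  by_cases h0 : R x y = 0
  · simp [h0]
  have h1 := lt_of_le_of_ne (hR.nonneg x y h) (Ne.symm h0)
  have h2 := lt_of_le_of_ne (hR.nonneg y x h.symm) (hR.symm x y h h0).symm
  have h3 : ∀ r : ℝ, 0 < r → Real.exp (Real.log r / 2) = Real.sqrt r := fun r hr => by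
    rw [Real.sqrt_eq_rpow, Real.rpow_def_of_pos hr]; congr 1; ring
  rw [noneqEntropyProduction, entropyProduction, Real.log_div h1.ne' h2.ne',
    Real.sqrt_mul h1.le, ← h3 _ h1, ← h3 _ h2, ← Real.exp_sub]
  conv_lhs => rw [← Real.exp_log h1]
  rw [Real.log_exp, ← Real.exp_add, ← Real.exp_add, ← Real.exp_add]
  congr 1
  ring

/-- The semigroup of the tilted generator in terms of an eigenbasis of the symmetrized one. -/
def spectralSemigroup (e : S → S → ℝ) (μ : S → ℝ) (w : S → ℝ) (φ : S → ℝ) (t : ℝ) (x : S) : ℝ :=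
  w x * ∑ i, Real.exp (μ i * t) * ((∑ y, e i y * (φ y / w y)) * e i x)

lemma IsReversibleSupport.isTiltedSemigroup (hR : IsReversibleSupport R) (β : ℝ) (H : S → ℝ)
    {e : S → S → ℝ} {μ : S → ℝ} (he : IsEigenbasis (symmetrizedRate R) e μ) :
    IsTiltedSemigroup R β H (spectralSemigroup e μ fun x => Real.exp (β * H x / 2)) := by
  set w : S → ℝ := fun x => Real.exp (β * H x / 2) with hw
  have hw0 : ∀ x, w x ≠ 0 := fun x => (Real.exp_pos _).ne'
  refine fun φ => ⟨fun t x => ?_, fun x => ?_⟩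
  · have hd : HasDerivAt (fun t => spectralSemigroup e μ w φ t x)
        (w x * ∑ i, (Real.exp (μ i * t) * (μ i * 1)) * ((∑ y, e i y * (φ y / w y)) * e i x)) t :=
      HasDerivAt.const_mul _ (HasDerivAt.fun_sum fun i _ =>
        HasDerivAt.mul_const (((hasDerivAt_id t).const_mul (μ i)).exp) _)
    refine hd.congr_deriv ?_
    -- The tilted generator acts on `w g` as `w` times the symmetrized generator acts on `g`. The
    -- diagonal is treated apart because `tiltedRate` is zero there while `symmetrizedRate` carries
    -- the escape rate.
    have h1 : ∑ y, tiltedRate R β H x y * spectralSemigroup e μ w φ t y -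
        escapeRate R x * spectralSemigroup e μ w φ t x =
        ∑ y, w x * (symmetrizedRate R x y * (spectralSemigroup e μ w φ t y / w y)) := by
      rw [← Finset.add_sum_erase _ _ (Finset.mem_univ x),
        ← Finset.add_sum_erase (a := x) _ _ (Finset.mem_univ x)]
      have h2 : ∀ y ∈ Finset.univ.erase x, tiltedRate R β H x y * spectralSemigroup e μ w φ t y =
          w x * (symmetrizedRate R x y * (spectralSemigroup e μ w φ t y / w y)) := by
        intro y hy
        rw [hR.tiltedRate_eq β H (Finset.ne_of_mem_erase hy).symm]
        ring
      have h3 := hw0 x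
      rw [Finset.sum_congr rfl h2, tiltedRate, if_pos rfl, symmetrizedRate, if_pos rfl]
      field_simp
      ring
    rw [h1, ← Finset.mul_sum]
    congr 1
    have h4 : ∀ y, spectralSemigroup e μ w φ t y / w y =
        ∑ i, Real.exp (μ i * t) * ((∑ y, e i y * (φ y / w y)) * e i y) := fun y =>
      mul_div_cancel_left₀ _ (hw0 y)
    simp_rw [h4, Finset.mul_sum (s := Finset.univ) (f := fun i => Real.exp (μ i * t) * _)]
    rw [Finset.sum_comm]
    refine Finset.sum_congr rfl fun i _ => ?_
    calc _ = Real.exp (μ i * t) * (∑ y, e i y * (φ y / w y)) * (μ i * e i x) := by ring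
      _ = _ := by
        rw [← he.eigen i x, Finset.mul_sum]
        exact Finset.sum_congr rfl fun _ _ => by ring
  · simp only [spectralSemigroup, mul_zero, Real.exp_zero, one_mul]
    rw [he.expand (fun y => φ y / w y) x]
    exact mul_div_cancel₀ _ (hw0 x)

/-- After removing the top growth rate, every other mode decays by the spectral gap, leaving the
projection onto the top eigenvector. -/
lemma tendsto_spectralSemigroup {e : S → S → ℝ} {μ : S → ℝ} {i₀ : S}
    (hi : ∀ i, i ≠ i₀ → μ i < μ i₀) (w φ : S → ℝ) (x : S) :
    Tendsto (fun t => Real.exp (-(μ i₀ * t)) * spectralSemigroup e μ w φ t x) atTop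
      (𝓝 (w x * ((∑ y, e i₀ y * (φ y / w y)) * e i₀ x))) := by
  have h1 : ∀ t, Real.exp (-(μ i₀ * t)) * spectralSemigroup e μ w φ t x =
      w x * ∑ i, Real.exp (-((μ i₀ - μ i) * t)) * ((∑ y, e i y * (φ y / w y)) * e i x) := by
    intro t
    rw [spectralSemigroup, mul_left_comm, Finset.mul_sum]
    congr 1
    refine Finset.sum_congr rfl fun i _ => ?_
    rw [← mul_assoc, ← Real.exp_add]
    congr 2
    ring
  simp_rw [h1]
  refine Tendsto.const_mul _ ?_
  have h2 : ∀ i ∈ Finset.univ, Tendsto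
      (fun t => Real.exp (-((μ i₀ - μ i) * t)) * ((∑ y, e i y * (φ y / w y)) * e i x)) atTop
      (𝓝 (if i = i₀ then (∑ y, e i y * (φ y / w y)) * e i x else 0)) := by
    intro i _
    by_cases h : i = i₀
    · subst h
      simp
    · rw [if_neg h]
      have h3 : Tendsto (fun t => Real.exp (-((μ i₀ - μ i) * t))) atTop (𝓝 0) :=
        Real.tendsto_exp_neg_atTop_nhds_zero.comp
          (tendsto_id.const_mul_atTop (sub_pos.2 (hi i h)))
      simpa using h3.mul_const ((∑ y, e i y * (φ y / w y)) * e i x)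
  simpa using tendsto_finsetSum _ h2

/-- The limit that defines the free energy, in terms of the Perron eigenvector. -/
theorem IsReversibleSupport.tendsto_freeEnergy (hR : IsReversibleSupport R) (β : ℝ) (H : S → ℝ)
    {e : S → S → ℝ} {μ : S → ℝ} {i₀ : S} (he : IsEigenbasis (symmetrizedRate R) e μ)
    (hi : ∀ i, i ≠ i₀ → μ i < μ i₀) (hpos : ∀ x, 0 < e i₀ x) {ρ : S → ℝ} (hρ : ∀ x, 0 ≤ ρ x)
    (hρ1 : ∑ x, ρ x = 1) (x : S) :
    Tendsto (fun τ : ℝ => Real.exp (-(β * H x)) *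
      (expectationFrom R (-τ) (-(τ / 2)) x
          (fun n y _ => Real.exp (-(pathNoneqEntropyProduction R β H n y / 2))) /
        expectationStTo R ρ (τ / 2) τ x
          (fun n y _ => Real.exp (-(pathNoneqEntropyProduction R β H n y / 2)))))
    atTop (𝓝 ((∑ y, e i₀ y / Real.exp (β * H y / 2)) /
      ∑ y, ρ y * (Real.exp (β * H y / 2) * e i₀ y))) := by
  have hV := hR.isTiltedSemigroup β H he
  set w : S → ℝ := fun x => Real.exp (β * H x / 2) with hw
  have hw0 : ∀ x, 0 < w x := fun x => Real.exp_pos _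
  have hden : 0 < ∑ y, ρ y * (w y * e i₀ y) := by
    have hn : ∀ y ∈ Finset.univ, 0 ≤ ρ y * (w y * e i₀ y) := fun y _ =>
      mul_nonneg (hρ y) (mul_pos (hw0 y) (hpos y)).le
    refine lt_of_le_of_ne (Finset.sum_nonneg hn) fun h0 => ?_
    have h1 := (Finset.sum_eq_zero_iff_of_nonneg hn).1 h0.symm
    have h2 : ∀ y, ρ y = 0 := fun y =>
      (mul_eq_zero.1 (h1 y (Finset.mem_univ y))).resolve_right (mul_pos (hw0 y) (hpos y)).ne'
    simp [h2] at hρ1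
  have htwo : Tendsto (fun τ : ℝ => τ / 2) atTop atTop :=
    tendsto_id.atTop_div_const (by norm_num)
  have hA := (tendsto_spectralSemigroup (e := e) hi w (fun _ => 1) x).comp htwo
  have hB := (tendsto_finsetSum Finset.univ fun z _ => (tendsto_spectralSemigroup (e := e) hi w
    (fun y => if y = x then 1 else 0) z).const_mul (ρ z)).comp htwo
  have hBv : ∑ z, ρ z * (w z * ((∑ y, e i₀ y * ((if y = x then 1 else 0) / w y)) * e i₀ z)) =
      e i₀ x / w x * ∑ y, ρ y * (w y * e i₀ y) := by
    rw [Finset.mul_sum]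
    refine Finset.sum_congr rfl fun z _ => ?_
    have : ∑ y, e i₀ y * ((if y = x then 1 else 0) / w y) = e i₀ x / w x := by
      simp [div_eq_mul_inv]
    rw [this]
    ring
  rw [hBv] at hB
  have hlim := (hA.div hB (mul_pos (div_pos (hpos x) (hw0 x)) hden).ne').const_mul
    (Real.exp (-(β * H x)))
  -- The numerator carries `w x * e i₀ x` and the denominator `e i₀ x / w x`. Their quotient `w x ^
  -- 2` is cancelled by `e^{-βH_x}`, so the limit does not depend on `x`.
  have hval : Real.exp (-(β * H x)) * (w x * ((∑ y, e i₀ y * (1 / w y)) * e i₀ x) /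
      (e i₀ x / w x * ∑ y, ρ y * (w y * e i₀ y))) =
      (∑ y, e i₀ y / w y) / ∑ y, ρ y * (w y * e i₀ y) := by
    have h1 : Real.exp (-(β * H x)) = (w x * w x)⁻¹ := by
      rw [← Real.exp_add, ← Real.exp_neg]
      congr 1
      ring
    rw [h1]
    simp_rw [mul_one_div]
    have := (hw0 x).ne'
    have := (hpos x).ne'
    have := hden.ne'
    field_simp
  rw [hval] at hlim
  refine hlim.congr' ?_
  -- The semigroup formulas require the endpoints of the time intervals to be ordered. Both
  -- intervals have length `τ / 2`, so the growth factors agree.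
  filter_upwards [eventually_ge_atTop 0] with τ hτ
  rw [hV.expectationFrom_eq hR.nonneg (by linarith), hV.expectationStTo_eq hR.nonneg ρ (by linarith)]
  have e1 : -(τ / 2) - -τ = τ / 2 := by ring
  have e2 : τ - τ / 2 = τ / 2 := by ring
  rw [e1, e2]
  simp only [Function.comp_apply, Pi.div_apply]
  congr 1
  have h1 : ∑ z, ρ z * (Real.exp (-(μ i₀ * (τ / 2))) *
      spectralSemigroup e μ w (fun y => if y = x then 1 else 0) (τ / 2) z) =
      Real.exp (-(μ i₀ * (τ / 2))) * ∑ z, ρ z *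
        spectralSemigroup e μ w (fun y => if y = x then 1 else 0) (τ / 2) z := by
    rw [Finset.mul_sum]
    exact Finset.sum_congr rfl fun _ _ => by ring
  rw [h1, mul_div_mul_left _ _ (Real.exp_pos _).ne']

end FreeEnergy

/-! ### The stationary distribution -/

section Stationary

variable {S : Type*} [Fintype S] [DecidableEq S] {R : S → S → ℝ}

lemma sum_rateMatrix_mul (R : S → S → ℝ) (f : S → ℝ) (x : S) :
    ∑ y, rateMatrix R x y * f y =
      -escapeRate R x * f x + ∑ y ∈ Finset.univ.erase x, R y x * f y := by
  rw [← Finset.add_sum_erase _ _ (Finset.mem_univ x)]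
  congr 1
  · simp [rateMatrix]
  · refine Finset.sum_congr rfl fun y hy => ?_
    simp [rateMatrix, (Finset.ne_of_mem_erase hy).symm]

lemma sum_rateMatrix_column (R : S → S → ℝ) (y : S) : ∑ x, rateMatrix R x y = 0 := by
  rw [← Finset.add_sum_erase _ _ (Finset.mem_univ y)]
  have h : ∑ x ∈ Finset.univ.erase y, rateMatrix R x y = escapeRate R y := by
    rw [escapeRate, Finset.filter_ne']
    refine Finset.sum_congr rfl fun x hx => ?_
    simp [rateMatrix, Finset.ne_of_mem_erase hx]
  rw [h]
  simp [rateMatrix]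

lemma rateMatrix_mulVec_eq_zero_iff (R : S → S → ℝ) (f : S → ℝ) :
    (rateMatrix R).mulVec f = 0 ↔ ∀ x, ∑ y, rateMatrix R x y * f y = 0 :=
  funext_iff

/-- The triangle inequality makes every component for `|f|` nonnegative, and the components sum to
zero because the columns of the rate matrix do. -/
lemma rateMatrix_mulVec_abs (hR : ∀ x y, x ≠ y → 0 ≤ R x y) {f : S → ℝ}
    (hf : ∀ x, ∑ y, rateMatrix R x y * f y = 0) (x : S) :
    ∑ y, rateMatrix R x y * |f y| = 0 := by
  have hn : ∀ x ∈ Finset.univ, 0 ≤ ∑ y, rateMatrix R x y * |f y| := by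
    intro x _
    have h1 := hf x
    rw [sum_rateMatrix_mul] at h1 ⊢
    have h2 : escapeRate R x * f x = ∑ y ∈ Finset.univ.erase x, R y x * f y := by linarith
    have h3 : escapeRate R x * |f x| ≤ ∑ y ∈ Finset.univ.erase x, R y x * |f y| := by
      rw [← abs_of_nonneg (escapeRate_nonneg hR x), ← abs_mul, h2]
      refine (Finset.abs_sum_le_sum_abs _ _).trans (Finset.sum_le_sum fun y hy => ?_)
      rw [abs_mul, abs_of_nonneg (hR y x (Finset.ne_of_mem_erase hy))]
    linarith
  have hs : ∑ x, ∑ y, rateMatrix R x y * |f y| = 0 := by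
    rw [Finset.sum_comm]
    simp_rw [← Finset.sum_mul, sum_rateMatrix_column]
    simp
  exact (Finset.sum_eq_zero_iff_of_nonneg hn).1 hs x (Finset.mem_univ x)

lemma IsReversibleSupport.eq_zero_of_stationary (hR : IsReversibleSupport R) {f : S → ℝ}
    (hf : ∀ x, 0 ≤ f x) (he : ∀ x, ∑ y, rateMatrix R x y * f y = 0) {x₀ : S} (h0 : f x₀ = 0)
    (x : S) : f x = 0 := by
  refine eq_zero_of_eigen_of_nonneg (G := fun x y => rateMatrix R x y) (m := 0) (fun x y h => ?_)
    (fun x y => ?_) hf (fun x => by rw [he, zero_mul]) h0 x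
  · simpa [rateMatrix, h] using hR.nonneg y x h.symm
  · refine Relation.ReflTransGen.mono (fun u v h => ?_) x y (hR.connected x y)
    refine ⟨h.1, ?_⟩
    simpa [rateMatrix, h.1] using hR.symm u v h.1 h.2

lemma IsReversibleSupport.stationary_pos (hR : IsReversibleSupport R) {ρ : S → ℝ}
    (hρ : IsStationaryDistribution R ρ) (x : S) : 0 < ρ x := by
  refine lt_of_le_of_ne (hρ.1 x) fun h => ?_
  have hz := hR.eq_zero_of_stationary hρ.1 ((rateMatrix_mulVec_eq_zero_iff R ρ).1 hρ.2.2) h.symm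
  have := hρ.2.1
  simp [hz] at this

theorem IsReversibleSupport.existsUnique_stationary [Nonempty S] (hR : IsReversibleSupport R) :
    ∃! ρ : S → ℝ, IsStationaryDistribution R ρ := by
  obtain ⟨x₀⟩ := ‹Nonempty S›
  have hdet : (rateMatrix R).det = 0 := by
    rw [← Matrix.exists_vecMul_eq_zero_iff]
    refine ⟨fun _ => 1, fun h => one_ne_zero (congrFun h x₀), ?_⟩
    ext y
    simpa [Matrix.vecMul, dotProduct] using sum_rateMatrix_column R y
  obtain ⟨f, hf0, hf⟩ := Matrix.exists_mulVec_eq_zero_iff.2 hdet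
  rw [rateMatrix_mulVec_eq_zero_iff] at hf
  have ha := rateMatrix_mulVec_abs hR.nonneg hf
  obtain ⟨x₁, hx₁⟩ := Function.ne_iff.1 hf0
  have hpos : 0 < ∑ x, |f x| :=
    Finset.sum_pos' (fun _ _ => abs_nonneg _) ⟨x₁, Finset.mem_univ _, abs_pos.2 hx₁⟩
  have hex : IsStationaryDistribution R fun x => |f x| / ∑ x, |f x| := by
    refine ⟨fun x => div_nonneg (abs_nonneg _) hpos.le, ?_, ?_⟩
    · rw [← Finset.sum_div, div_self hpos.ne']
    · rw [rateMatrix_mulVec_eq_zero_iff]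
      intro x
      simp_rw [← mul_div_assoc]
      rw [← Finset.sum_div, ha, zero_div]
  have huniq : ∀ ρ ρ' : S → ℝ, IsStationaryDistribution R ρ → IsStationaryDistribution R ρ' →
      ρ = ρ' := by
    intro ρ ρ' h h'
    have hd : ∀ x, ∑ y, rateMatrix R x y * (ρ y - ρ' y) = 0 := fun x => by
      simp_rw [mul_sub, Finset.sum_sub_distrib,
        (rateMatrix_mulVec_eq_zero_iff R ρ).1 h.2.2 x,
        (rateMatrix_mulVec_eq_zero_iff R ρ').1 h'.2.2 x, sub_zero]
    have hda := rateMatrix_mulVec_abs hR.nonneg hd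
    have hsum : ∑ x, (ρ x - ρ' x) = 0 := by
      rw [Finset.sum_sub_distrib, h.2.1, h'.2.1, sub_self]
    -- With `s` the sign of the difference at `x₀`, irreducibility makes `|ρ - ρ'| = s (ρ - ρ')`
    -- everywhere. The right-hand side sums to zero since both distributions have mass one.
    have key : ∀ s : ℝ, |ρ x₀ - ρ' x₀| = s * (ρ x₀ - ρ' x₀) →
        (∀ x, s * (ρ x - ρ' x) ≤ |ρ x - ρ' x|) → ρ = ρ' := by
      intro s hs hle
      have hz : ∀ x, |ρ x - ρ' x| - s * (ρ x - ρ' x) = 0 :=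
        hR.eq_zero_of_stationary (fun x => sub_nonneg.2 (hle x)) (fun x => by
          calc _ = ∑ y, rateMatrix R x y * |ρ y - ρ' y| -
                s * ∑ y, rateMatrix R x y * (ρ y - ρ' y) := by
                rw [Finset.mul_sum, ← Finset.sum_sub_distrib]
                exact Finset.sum_congr rfl fun _ _ => by ring
            _ = 0 := by rw [hda, hd, mul_zero, sub_zero]) (sub_eq_zero.2 hs)
      have h0 : ∑ x, |ρ x - ρ' x| = 0 := by
        calc _ = ∑ x, s * (ρ x - ρ' x) :=
              Finset.sum_congr rfl fun x _ => sub_eq_zero.1 (hz x)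
          _ = 0 := by rw [← Finset.mul_sum, hsum, mul_zero]
      ext x
      exact sub_eq_zero.1 (abs_eq_zero.1
        ((Finset.sum_eq_zero_iff_of_nonneg fun _ _ => abs_nonneg _).1 h0 x (Finset.mem_univ x)))
    rcases le_total 0 (ρ x₀ - ρ' x₀) with h0 | h0
    · exact key 1 (by rw [abs_of_nonneg h0, one_mul]) fun x => by
        rw [one_mul]; exact le_abs_self _
    · exact key (-1) (by rw [abs_of_nonpos h0, neg_one_mul]) fun x => by
        rw [neg_one_mul]; exact neg_le_abs _
  exact ⟨_, hex, fun ρ hρ => huniq _ _ hρ hex⟩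

end Stationary

/-! ### Poincaré inequality and the perturbation equations -/

section Perturbation

variable {S : Type*} [Fintype S]

/-- Poincaré inequality on a connected network. -/
lemma exists_poincare {c : S → S → ℝ} (hc0 : ∀ x y, 0 ≤ c x y)
    (hc : ∀ x y, Relation.ReflTransGen (fun u v => c u v ≠ 0) x y) :
    ∃ P : ℝ, 0 ≤ P ∧ ∀ (f : S → ℝ) (x y : S),
      (f x - f y) ^ 2 ≤ P * ∑ u, ∑ v, c u v * (f u - f v) ^ 2 := by
  have hterm : ∀ (f : S → ℝ) u v, 0 ≤ c u v * (f u - f v) ^ 2 := fun f u v =>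
    mul_nonneg (hc0 u v) (sq_nonneg _)
  have hE : ∀ f : S → ℝ, 0 ≤ ∑ u, ∑ v, c u v * (f u - f v) ^ 2 := fun f =>
    Finset.sum_nonneg fun u _ => Finset.sum_nonneg fun v _ => hterm f u v
  have key : ∀ x y, ∃ P : ℝ, 0 ≤ P ∧ ∀ f : S → ℝ,
      (f x - f y) ^ 2 ≤ P * ∑ u, ∑ v, c u v * (f u - f v) ^ 2 := by
    intro x y
    induction hc x y with
    | refl => exact ⟨0, le_rfl, fun f => by simp⟩
    | tail _ huv ih =>
      rename_i u v _
      obtain ⟨P, hP0, hP⟩ := ih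
      have hcuv : 0 < c u v := lt_of_le_of_ne (hc0 u v) (Ne.symm huv)
      -- Adding one edge to a chain uses `(s + t)² ≤ 2 s² + 2 t²`, and the edge alone is controlled
      -- by its own term in the Dirichlet form.
      refine ⟨2 * P + 2 / c u v, by positivity, fun f => ?_⟩
      have h1 : c u v * (f u - f v) ^ 2 ≤ ∑ u, ∑ v, c u v * (f u - f v) ^ 2 :=
        (Finset.single_le_sum (f := fun v => c u v * (f u - f v) ^ 2) (fun v _ => hterm f u v)
          (Finset.mem_univ v)).trans
        (Finset.single_le_sum (f := fun u => ∑ v, c u v * (f u - f v) ^ 2)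
          (fun u _ => Finset.sum_nonneg fun v _ => hterm f u v) (Finset.mem_univ u))
      have h2 : (f u - f v) ^ 2 ≤ (∑ u, ∑ v, c u v * (f u - f v) ^ 2) / c u v := by
        rw [le_div_iff₀ hcuv]
        linarith
      have h3 := hP f
      have h4 : (f x - f v) ^ 2 ≤ 2 * (f x - f u) ^ 2 + 2 * (f u - f v) ^ 2 := by
        nlinarith [sq_nonneg ((f x - f u) - (f u - f v))]
      calc (f x - f v) ^ 2 ≤ 2 * (f x - f u) ^ 2 + 2 * (f u - f v) ^ 2 := h4
        _ ≤ 2 * (P * ∑ u, ∑ v, c u v * (f u - f v) ^ 2) +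
            2 * ((∑ u, ∑ v, c u v * (f u - f v) ^ 2) / c u v) := by linarith
        _ = _ := by ring
  choose P hP0 hP using key
  refine ⟨∑ x, ∑ y, P x y, Finset.sum_nonneg fun x _ => Finset.sum_nonneg fun y _ => hP0 x y,
    fun f x y => (hP x y f).trans (mul_le_mul_of_nonneg_right ?_ (hE f))⟩
  exact (Finset.single_le_sum (f := fun y => P x y) (fun y _ => hP0 x y) (Finset.mem_univ y)).trans
    (Finset.single_le_sum (f := fun x => ∑ y, P x y)
      (fun x _ => Finset.sum_nonneg fun y _ => hP0 x y) (Finset.mem_univ x))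

/-- Summation by parts. The constant `a` is free because the Laplacian of `f` has total sum zero; it
will be a value of `f`, so that `f u - a` is bounded by the oscillation. -/
lemma dirichlet_form_eq {k : S → S → ℝ} (hk : ∀ x y, k x y = k y x) (f : S → ℝ) (a : ℝ) :
    ∑ u, ∑ v, k u v * (f u - f v) ^ 2 = -2 * ∑ u, (f u - a) * ∑ v, k u v * (f v - f u) := by
  have h1 : ∑ u, (f u - a) * ∑ v, k u v * (f v - f u) =
      ∑ u, ∑ v, k u v * ((f u - a) * (f v - f u)) := by
    simp_rw [Finset.mul_sum]
    exact Finset.sum_congr rfl fun _ _ => Finset.sum_congr rfl fun _ _ => by ring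
  have h2 : ∑ u, ∑ v, k u v * ((f u - a) * (f v - f u)) =
      ∑ u, ∑ v, k u v * ((f v - a) * (f u - f v)) := by
    rw [Finset.sum_comm]
    exact Finset.sum_congr rfl fun u _ => Finset.sum_congr rfl fun v _ => by rw [hk]
  have h3 : ∑ u, ∑ v, k u v * (f u - f v) ^ 2 = -(∑ u, ∑ v, k u v * ((f u - a) * (f v - f u)) +
      ∑ u, ∑ v, k u v * ((f v - a) * (f u - f v))) := by
    simp_rw [← Finset.sum_add_distrib, ← Finset.sum_neg_distrib]
    exact Finset.sum_congr rfl fun _ _ => Finset.sum_congr rfl fun _ _ => by ring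
  rw [h3, ← h2, h1]
  ring

/-- A function with small Laplacian has small oscillation. -/
lemma oscillation_le_of_laplacian_le [Nonempty S] {k : S → S → ℝ} (hk : ∀ x y, k x y = k y x)
    {P : ℝ} (hP0 : 0 ≤ P)
    (hP : ∀ (f : S → ℝ) (x y : S), (f x - f y) ^ 2 ≤ P * ∑ u, ∑ v, k u v * (f u - f v) ^ 2)
    {f : S → ℝ} {δ : ℝ} (hf : ∀ x, |∑ y, k x y * (f y - f x)| ≤ δ) (x y : S) :
    |f x - f y| ≤ 2 * P * Fintype.card S * δ := by
  obtain ⟨⟨x₁, y₁⟩, hmax⟩ := Finite.exists_max fun z : S × S => |f z.1 - f z.2|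
  have hδ : 0 ≤ δ := (abs_nonneg _).trans (hf x)
  set M := |f x₁ - f y₁| with hM
  have hM0 : 0 ≤ M := abs_nonneg _
  -- The Poincaré inequality at the pair of maximal difference, with the Dirichlet form bounded
  -- linearly in `M`; one factor `M` is then divided out.
  have h1 : M ^ 2 ≤ (2 * P * Fintype.card S * δ) * M := by
    have h2 := hP f x₁ y₁
    rw [dirichlet_form_eq hk f (f y₁)] at h2
    have h3 : |∑ u, (f u - f y₁) * ∑ v, k u v * (f v - f u)| ≤ Fintype.card S * (M * δ) := by
      refine (Finset.abs_sum_le_sum_abs _ _).trans ?_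
      rw [← nsmul_eq_mul, ← Finset.card_univ]
      refine Finset.sum_le_card_nsmul _ _ _ fun u _ => ?_
      rw [abs_mul]
      exact mul_le_mul (hmax (u, y₁)) (hf u) (abs_nonneg _) hM0
    rw [hM, sq_abs]
    have h4 := (abs_le.1 h3).1
    have h5 := mul_le_mul_of_nonneg_left h4 hP0
    linarith
  have h3 : M ≤ 2 * P * Fintype.card S * δ := by
    rcases hM0.eq_or_lt with h | h
    · rw [← h]; positivity
    · exact le_of_mul_le_mul_right (by linarith [sq M]) h
  exact (hmax (x, y)).trans h3

/-- A family of perturbed equilibrium networks, in terms of the symmetric conductances `k`, the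
Boltzmann weights `γ`, and the relative densities `p` and `v` of the stationary distribution and of
the Perron eigenvector (with eigenvalue `μ`). -/
structure IsPerturbation (c : S → S → ℝ) (B K ε : ℝ) (k ξ : S → S → ℝ) (γ p v : S → ℝ) (μ : ℝ) :
    Prop where
  B_ge : 1 ≤ B
  ε_nonneg : 0 ≤ ε
  k_symm : ∀ x y, k x y = k y x
  k_nonneg : ∀ x y, 0 ≤ k x y
  k_ge : ∀ x y, c x y ≤ B * k x y
  k_le : ∀ x y, k x y ≤ K
  ξ_bound : ∀ x y, |ξ x y| ≤ 1
  γ_ge : ∀ x, 1 ≤ B * γ x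
  γ_le : ∀ x, γ x ≤ B
  p_pos : ∀ x, 0 < p x
  v_pos : ∀ x, 0 < v x
  sum_p : ∑ x, γ x * p x = 1
  sum_v : ∑ x, γ x * v x = 1
  stat : ∀ x, ∑ y, k x y * (p y * Real.exp (ε * ξ y x) - p x * Real.exp (ε * ξ x y)) = 0
  eig : ∀ x, ∑ y, k x y * (v y * Real.exp (ε * (ξ x y + ξ y x) / 2) -
    v x * Real.exp (ε * ξ x y)) = μ * (γ x * v x)
  μ_nonpos : μ ≤ 0
  μ_ge : ∑ x, ∑ y, k x y * (Real.exp (ε * (ξ x y + ξ y x) / 2) - Real.exp (ε * ξ x y)) ≤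
    μ * ∑ x, γ x

end Perturbation

/-! ### First- and second-order response to the perturbation -/

lemma abs_exp_sub_one_le_of_abs_le {X ε : ℝ} (hX : |X| ≤ ε) (hε1 : ε ≤ 1) :
    |Real.exp X - 1| ≤ 2 * ε := by
  have := Real.abs_exp_sub_one_le (hX.trans hε1)
  linarith

lemma abs_mul_exp_sub_one_sub_le {X ε w u C B : ℝ} (hX : |X| ≤ ε) (hε1 : ε ≤ 1)
    (hw : |w - u| ≤ C * ε) (hu0 : 0 ≤ u) (hu : u ≤ B) :
    |w * (Real.exp X - 1) - u * X| ≤ (2 * C + B) * ε ^ 2 := by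
  have h1 := abs_exp_sub_one_le_of_abs_le hX hε1
  have h2 : |Real.exp X - 1 - X| ≤ ε ^ 2 := by
    refine (Real.abs_exp_sub_one_sub_id_le (hX.trans hε1)).trans ?_
    rw [← sq_abs]
    exact pow_le_pow_left₀ (abs_nonneg _) hX 2
  have h3 : w * (Real.exp X - 1) - u * X =
      (w - u) * (Real.exp X - 1) + u * (Real.exp X - 1 - X) := by ring
  rw [h3]
  calc _ ≤ |w - u| * |Real.exp X - 1| + |u| * |Real.exp X - 1 - X| := by
        rw [← abs_mul, ← abs_mul]; exact abs_add_le _ _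
    _ ≤ (C * ε) * (2 * ε) + B * ε ^ 2 := by
        rw [abs_of_nonneg hu0]
        exact add_le_add (mul_le_mul hw h1 (abs_nonneg _) ((abs_nonneg _).trans hw))
          (mul_le_mul hu h2 (abs_nonneg _) (hu0.trans hu))
    _ = _ := by ring

lemma abs_sum_le_card_mul {S : Type*} [Fintype S] {f : S → ℝ} {δ : ℝ} (h : ∀ x, |f x| ≤ δ) :
    |∑ x, f x| ≤ Fintype.card S * δ := by
  refine (Finset.abs_sum_le_sum_abs _ _).trans ?_
  rw [← nsmul_eq_mul, ← Finset.card_univ]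
  exact Finset.sum_le_card_nsmul _ _ _ fun x _ => h x

namespace IsPerturbation

variable {S : Type*} [Fintype S] {c : S → S → ℝ} {B K ε : ℝ} {k ξ : S → S → ℝ} {γ p v : S → ℝ}
  {μ : ℝ}

lemma B_pos (h : IsPerturbation c B K ε k ξ γ p v μ) : 0 < B := one_pos.trans_le h.B_ge

lemma γ_pos (h : IsPerturbation c B K ε k ξ γ p v μ) (x : S) : 0 < γ x :=
  pos_of_mul_pos_right (one_pos.trans_le (h.γ_ge x)) h.B_pos.le

lemma γ_mul_le (h : IsPerturbation c B K ε k ξ γ p v μ) {f : S → ℝ} (hf : ∀ x, 0 < f x)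
    (hs : ∑ x, γ x * f x = 1) (x : S) : γ x * f x ≤ 1 := by
  rw [← hs]
  exact Finset.single_le_sum (f := fun x => γ x * f x)
    (fun y _ => (mul_pos (h.γ_pos y) (hf y)).le) (Finset.mem_univ x)

lemma le_B (h : IsPerturbation c B K ε k ξ γ p v μ) {f : S → ℝ} (hf : ∀ x, 0 < f x)
    (hs : ∑ x, γ x * f x = 1) (x : S) : f x ≤ B := by
  have h1 := h.γ_mul_le hf hs x
  have h2 := mul_le_mul_of_nonneg_right (h.γ_ge x) (hf x).le
  have h3 := mul_le_mul_of_nonneg_left h1 h.B_pos.le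
  linarith

lemma K_nonneg [Nonempty S] (h : IsPerturbation c B K ε k ξ γ p v μ) : 0 ≤ K := by
  obtain ⟨x⟩ := ‹Nonempty S›
  exact (h.k_nonneg x x).trans (h.k_le x x)

lemma Z_ge [Nonempty S] (h : IsPerturbation c B K ε k ξ γ p v μ) : 1 ≤ B * ∑ x, γ x := by
  obtain ⟨x⟩ := ‹Nonempty S›
  refine (h.γ_ge x).trans (mul_le_mul_of_nonneg_left ?_ h.B_pos.le)
  exact Finset.single_le_sum (f := γ) (fun y _ => (h.γ_pos y).le) (Finset.mem_univ x)

lemma Z_pos [Nonempty S] (h : IsPerturbation c B K ε k ξ γ p v μ) : 0 < ∑ x, γ x :=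
  pos_of_mul_pos_right (one_pos.trans_le h.Z_ge) h.B_pos.le

lemma Z_le (h : IsPerturbation c B K ε k ξ γ p v μ) : ∑ x, γ x ≤ Fintype.card S * B := by
  rw [← nsmul_eq_mul, ← Finset.card_univ]
  exact Finset.sum_le_card_nsmul _ _ _ fun x _ => h.γ_le x

lemma inv_Z_le [Nonempty S] (h : IsPerturbation c B K ε k ξ γ p v μ) : (∑ x, γ x)⁻¹ ≤ B := by
  rw [inv_le_iff_one_le_mul₀ h.Z_pos]
  exact h.Z_ge

lemma abs_εξ_le (h : IsPerturbation c B K ε k ξ γ p v μ) (x y : S) : |ε * ξ x y| ≤ ε := by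
  rw [abs_mul, abs_of_nonneg h.ε_nonneg]
  exact mul_le_of_le_one_right h.ε_nonneg (h.ξ_bound x y)

lemma abs_εξ_symm_le (h : IsPerturbation c B K ε k ξ γ p v μ) (x y : S) :
    |ε * (ξ x y + ξ y x) / 2| ≤ ε := by
  have h1 := abs_le.1 (h.abs_εξ_le x y)
  have h2 := abs_le.1 (h.abs_εξ_le y x)
  rw [abs_le]
  constructor <;> linarith

/-- The lower bound `μ_ge` is the variational one for the constant trial density. By the symmetry of
`k` its left side is minus half a sum of squares of differences of `e^{εξ/2}`, hence quadratic in
`ε`. This keeps the eigenvalue out of the first-order response. -/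
lemma neg_μ_le [Nonempty S] (h : IsPerturbation c B K ε k ξ γ p v μ) (hε1 : ε ≤ 1) :
    -μ ≤ 2 * Fintype.card S ^ 2 * K * B * ε ^ 2 := by
  have hε := h.ε_nonneg
  have h1 : ∑ x, ∑ y, k x y * (Real.exp (ε * (ξ x y + ξ y x) / 2) - Real.exp (ε * ξ x y)) =
      -(1 / 2) * ∑ x, ∑ y,
        k x y * (Real.exp (ε * ξ x y / 2) - Real.exp (ε * ξ y x / 2)) ^ 2 := by
    have h2 : ∑ x, ∑ y, k x y * Real.exp (ε * ξ x y) = ∑ x, ∑ y, k x y * Real.exp (ε * ξ y x) := by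
      rw [Finset.sum_comm]
      exact Finset.sum_congr rfl fun _ _ => Finset.sum_congr rfl fun _ _ => by rw [h.k_symm]
    have h3 : ∀ x y, k x y * (Real.exp (ε * ξ x y / 2) - Real.exp (ε * ξ y x / 2)) ^ 2 =
        k x y * Real.exp (ε * ξ x y) + k x y * Real.exp (ε * ξ y x) -
          2 * (k x y * Real.exp (ε * (ξ x y + ξ y x) / 2)) := by
      intro x y
      have e1 : Real.exp (ε * ξ x y) = Real.exp (ε * ξ x y / 2) * Real.exp (ε * ξ x y / 2) := by
        rw [← Real.exp_add]; congr 1; ring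
      have e2 : Real.exp (ε * ξ y x) = Real.exp (ε * ξ y x / 2) * Real.exp (ε * ξ y x / 2) := by
        rw [← Real.exp_add]; congr 1; ring
      have e3 : Real.exp (ε * (ξ x y + ξ y x) / 2) =
          Real.exp (ε * ξ x y / 2) * Real.exp (ε * ξ y x / 2) := by
        rw [← Real.exp_add]; congr 1; ring
      rw [e1, e2, e3]
      ring
    simp_rw [h3, mul_sub, Finset.sum_sub_distrib, Finset.sum_add_distrib, ← Finset.mul_sum]
    rw [← h2]
    ring
  have h4 : ∑ x, ∑ y, k x y * (Real.exp (ε * ξ x y / 2) - Real.exp (ε * ξ y x / 2)) ^ 2 ≤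
      Fintype.card S * (Fintype.card S * (K * (2 * ε) ^ 2)) := by
    refine (le_abs_self _).trans (abs_sum_le_card_mul fun x => abs_sum_le_card_mul fun y => ?_)
    rw [abs_of_nonneg (mul_nonneg (h.k_nonneg x y) (sq_nonneg _)), ← sq_abs (_ - _)]
    have h5 : ∀ x y, |Real.exp (ε * ξ x y / 2) - 1| ≤ ε := fun x y => by
      have h6 : |ε * ξ x y / 2| ≤ ε / 2 := by
        rw [abs_div, abs_two]
        have := h.abs_εξ_le x y
        linarith
      have := abs_exp_sub_one_le_of_abs_le h6 (by linarith)
      linarith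
    have h7 : |Real.exp (ε * ξ x y / 2) - Real.exp (ε * ξ y x / 2)| ≤ 2 * ε := by
      have h8 := abs_sub_le (Real.exp (ε * ξ x y / 2)) 1 (Real.exp (ε * ξ y x / 2))
      rw [abs_sub_comm 1] at h8
      linarith [h5 x y, h5 y x]
    exact mul_le_mul (h.k_le x y) (pow_le_pow_left₀ (abs_nonneg _) h7 2) (by positivity) h.K_nonneg
  have h9 := h.μ_ge
  rw [h1] at h9
  have h10 : -μ * 1 ≤ -μ * (B * ∑ x, γ x) :=
    mul_le_mul_of_nonneg_left h.Z_ge (neg_nonneg.2 h.μ_nonpos)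
  have h11 := mul_le_mul_of_nonneg_left (h9.trans' (mul_le_mul_of_nonpos_left h4
    (by norm_num : (-(1 / 2) : ℝ) ≤ 0))) h.B_pos.le
  linarith

lemma abs_μ_mul_le [Nonempty S] (h : IsPerturbation c B K ε k ξ γ p v μ) (hε1 : ε ≤ 1) (x : S) :
    |μ * (γ x * v x)| ≤ 2 * Fintype.card S ^ 2 * K * B * ε ^ 2 := by
  have h1 := h.γ_mul_le h.v_pos h.sum_v x
  have h2 : 0 ≤ γ x * v x := (mul_pos (h.γ_pos x) (h.v_pos x)).le
  rw [abs_mul, abs_of_nonpos h.μ_nonpos, abs_of_nonneg h2]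
  exact (mul_le_of_le_one_right (neg_nonneg.2 h.μ_nonpos) h1).trans (h.neg_μ_le hε1)

/-- A bound for the first-order response. -/
def responseConst (n P K B : ℝ) : ℝ := 2 * P * n * (4 * n * K * B + 2 * n ^ 2 * K * B)

lemma abs_flux_le (h : IsPerturbation c B K ε k ξ γ p v μ) (hε1 : ε ≤ 1) {f : S → ℝ}
    (hf0 : ∀ x, 0 < f x) (hfB : ∀ x, f x ≤ B) {X Y : ℝ} (hX : |X| ≤ ε) (hY : |Y| ≤ ε) (x y : S) :
    |k x y * (f y * (Real.exp X - 1) - f x * (Real.exp Y - 1))| ≤ K * (4 * B * ε) := by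
  have h1 := abs_exp_sub_one_le_of_abs_le hX hε1
  have h2 := abs_exp_sub_one_le_of_abs_le hY hε1
  have hε := h.ε_nonneg
  rw [abs_mul, abs_of_nonneg (h.k_nonneg x y)]
  refine mul_le_mul (h.k_le x y) ?_ (abs_nonneg _) ((h.k_nonneg x y).trans (h.k_le x y))
  refine (abs_sub _ _).trans ?_
  rw [abs_mul, abs_mul, abs_of_pos (hf0 y), abs_of_pos (hf0 x)]
  have h3 := mul_le_mul (hfB y) h1 (abs_nonneg _) h.B_pos.le
  have h4 := mul_le_mul (hfB x) h2 (abs_nonneg _) h.B_pos.le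
  linarith

variable {P : ℝ}

lemma abs_p_sub_p_le [Nonempty S] (h : IsPerturbation c B K ε k ξ γ p v μ) (hε1 : ε ≤ 1)
    (hP0 : 0 ≤ P)
    (hP : ∀ (f : S → ℝ) (x y : S), (f x - f y) ^ 2 ≤ P * ∑ u, ∑ v, k u v * (f u - f v) ^ 2)
    (x y : S) : |p x - p y| ≤ responseConst (Fintype.card S) P K B * ε := by
  have hK := h.K_nonneg
  have hB := h.B_pos
  have hε := h.ε_nonneg
  have h1 : ∀ x, |∑ y, k x y * (p y - p x)| ≤ Fintype.card S * (K * (4 * B * ε)) := by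
    intro x
    have h2 : ∑ y, k x y * (p y - p x) = -∑ y, k x y * (p y * (Real.exp (ε * ξ y x) - 1) -
        p x * (Real.exp (ε * ξ x y) - 1)) := by
      rw [← sub_zero (∑ y, k x y * (p y - p x)), ← h.stat x, ← Finset.sum_sub_distrib,
        ← Finset.sum_neg_distrib]
      exact Finset.sum_congr rfl fun _ _ => by ring
    rw [h2, abs_neg]
    exact abs_sum_le_card_mul fun y => h.abs_flux_le hε1 h.p_pos (h.le_B h.p_pos h.sum_p)
      (h.abs_εξ_le y x) (h.abs_εξ_le x y) x y
  refine (oscillation_le_of_laplacian_le h.k_symm hP0 hP h1 x y).trans ?_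
  -- The second term of `responseConst` pays for the eigenvalue, which occurs only in the equation
  -- for `v`; here it is slack.
  have h3 : 0 ≤ 2 * P * Fintype.card S * (2 * (Fintype.card S : ℝ) ^ 2 * K * B) * ε := by
    positivity
  rw [responseConst]
  linarith

lemma abs_v_sub_v_le [Nonempty S] (h : IsPerturbation c B K ε k ξ γ p v μ) (hε1 : ε ≤ 1)
    (hP0 : 0 ≤ P)
    (hP : ∀ (f : S → ℝ) (x y : S), (f x - f y) ^ 2 ≤ P * ∑ u, ∑ v, k u v * (f u - f v) ^ 2)
    (x y : S) : |v x - v y| ≤ responseConst (Fintype.card S) P K B * ε := by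
  have hK := h.K_nonneg
  have hB := h.B_pos
  have hε := h.ε_nonneg
  have h1 : ∀ x, |∑ y, k x y * (v y - v x)| ≤
      2 * Fintype.card S ^ 2 * K * B * ε + Fintype.card S * (K * (4 * B * ε)) := by
    intro x
    have h2 : ∑ y, k x y * (v y - v x) = μ * (γ x * v x) -
        ∑ y, k x y * (v y * (Real.exp (ε * (ξ x y + ξ y x) / 2) - 1) -
        v x * (Real.exp (ε * ξ x y) - 1)) := by
      rw [← h.eig x, ← Finset.sum_sub_distrib]
      exact Finset.sum_congr rfl fun _ _ => by ring
    rw [h2]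
    refine (abs_sub _ _).trans (add_le_add ((h.abs_μ_mul_le hε1 x).trans ?_)
      (abs_sum_le_card_mul fun y => h.abs_flux_le hε1 h.v_pos (h.le_B h.v_pos h.sum_v)
        (h.abs_εξ_symm_le x y) (h.abs_εξ_le x y) x y))
    refine mul_le_mul_of_nonneg_left ?_ (by positivity)
    nlinarith
  refine (oscillation_le_of_laplacian_le h.k_symm hP0 hP h1 x y).trans (le_of_eq ?_)
  rw [responseConst]
  ring

/-- The `γ`-average of `f` is `1 / Z`, so the deviation at `x` is an average of the differences `f x
- f y`. -/
lemma abs_sub_inv_Z_le [Nonempty S] (h : IsPerturbation c B K ε k ξ γ p v μ) {f : S → ℝ}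
    (hs : ∑ x, γ x * f x = 1) {δ : ℝ} (hf : ∀ x y, |f x - f y| ≤ δ) (x : S) :
    |f x - (∑ x, γ x)⁻¹| ≤ δ := by
  have hZ := h.Z_pos
  have h1 : f x - (∑ x, γ x)⁻¹ = (∑ x, γ x)⁻¹ * ∑ y, γ y * (f x - f y) := by
    simp_rw [mul_sub, Finset.sum_sub_distrib, hs, ← Finset.sum_mul]
    field_simp
  rw [h1, abs_mul, abs_of_pos (inv_pos.2 hZ), inv_mul_le_iff₀ hZ, Finset.sum_mul]
  refine (Finset.abs_sum_le_sum_abs _ _).trans (Finset.sum_le_sum fun y _ => ?_)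
  rw [abs_mul, abs_of_pos (h.γ_pos y)]
  exact mul_le_mul_of_nonneg_left (hf x y) (h.γ_pos y).le

/-- A bound for the second-order response. -/
def responseConst₂ (n P K B : ℝ) : ℝ :=
  2 * P * n * (2 * (2 * n ^ 2 * K * B) + n * (K * (6 * (2 * responseConst n P K B + B))))

/-- To first order, the response of the Perron eigenvector is half the response of the
stationary distribution. -/
lemma abs_two_mul_v_sub_p_le [Nonempty S] (h : IsPerturbation c B K ε k ξ γ p v μ) (hε1 : ε ≤ 1)
    (hP0 : 0 ≤ P)
    (hP : ∀ (f : S → ℝ) (x y : S), (f x - f y) ^ 2 ≤ P * ∑ u, ∑ v, k u v * (f u - f v) ^ 2)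
    (x : S) : |2 * v x - p x - (∑ x, γ x)⁻¹| ≤
      responseConst₂ (Fintype.card S) P K B * ε ^ 2 := by
  have hp := h.abs_sub_inv_Z_le h.sum_p (h.abs_p_sub_p_le hε1 hP0 hP)
  have hv := h.abs_sub_inv_Z_le h.sum_v (h.abs_v_sub_v_le hε1 hP0 hP)
  set C := responseConst (Fintype.card S) P K B with hC
  set u := (∑ x, γ x)⁻¹ with hu
  have hu0 : 0 ≤ u := (inv_pos.2 h.Z_pos).le
  have huB : u ≤ B := h.inv_Z_le
  have h1 : ∀ x, |∑ y, k x y * ((2 * v y - p y) - (2 * v x - p x))| ≤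
      2 * (2 * Fintype.card S ^ 2 * K * B * ε ^ 2) +
        Fintype.card S * (K * (6 * (2 * C + B) * ε ^ 2)) := by
    intro x
    -- Twice the eigenvalue equation is combined with stationarity. The subtracted linear terms `u *
    -- (ε * …)` cancel: `-(ξ x y + ξ y x) + 2 ξ x y + ξ y x - ξ x y = 0`. The four second-order
    -- remainders have coefficients of total size `6`.
    have h2 : ∑ y, k x y * ((2 * v y - p y) - (2 * v x - p x)) = 2 * (μ * (γ x * v x)) +
        ∑ y, k x y * (
          -2 * (v y * (Real.exp (ε * (ξ x y + ξ y x) / 2) - 1) - u * (ε * (ξ x y + ξ y x) / 2)) +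
          2 * (v x * (Real.exp (ε * ξ x y) - 1) - u * (ε * ξ x y)) +
          (p y * (Real.exp (ε * ξ y x) - 1) - u * (ε * ξ y x)) -
          (p x * (Real.exp (ε * ξ x y) - 1) - u * (ε * ξ x y))) := by
      rw [← h.eig x, ← add_zero (∑ y, k x y * ((2 * v y - p y) - (2 * v x - p x))), ← h.stat x,
        Finset.mul_sum, ← Finset.sum_add_distrib, ← Finset.sum_add_distrib]
      exact Finset.sum_congr rfl fun _ _ => by ring
    rw [h2]
    refine (abs_add_le _ _).trans (add_le_add ?_ (abs_sum_le_card_mul fun y => ?_))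
    · rw [abs_mul, abs_two]
      exact mul_le_mul_of_nonneg_left (h.abs_μ_mul_le hε1 x) zero_le_two
    · rw [abs_mul, abs_of_nonneg (h.k_nonneg x y)]
      refine mul_le_mul (h.k_le x y) ?_ (abs_nonneg _) h.K_nonneg
      have e1 := abs_le.1 (abs_mul_exp_sub_one_sub_le (h.abs_εξ_symm_le x y) hε1 (hv y) hu0 huB)
      have e2 := abs_le.1 (abs_mul_exp_sub_one_sub_le (h.abs_εξ_le x y) hε1 (hv x) hu0 huB)
      have e3 := abs_le.1 (abs_mul_exp_sub_one_sub_le (h.abs_εξ_le y x) hε1 (hp y) hu0 huB)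
      have e4 := abs_le.1 (abs_mul_exp_sub_one_sub_le (h.abs_εξ_le x y) hε1 (hp x) hu0 huB)
      rw [abs_le]
      constructor <;> linarith [e1.1, e1.2, e2.1, e2.2, e3.1, e3.2, e4.1, e4.2]
  have hs : ∑ x, γ x * (2 * v x - p x) = 1 := by
    have : ∑ x, γ x * (2 * v x - p x) = 2 * (∑ x, γ x * v x) - ∑ x, γ x * p x := by
      rw [Finset.mul_sum, ← Finset.sum_sub_distrib]
      exact Finset.sum_congr rfl fun _ _ => by ring
    rw [this, h.sum_v, h.sum_p]
    norm_num
  refine (h.abs_sub_inv_Z_le hs (oscillation_le_of_laplacian_le h.k_symm hP0 hP h1) x).trans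
    (le_of_eq ?_)
  rw [responseConst₂, ← hC]
  ring

end IsPerturbation

/-! ### Entropy expansion for small perturbations -/

lemma abs_log_one_add_sub_le {s : ℝ} (hs : |s| ≤ 1 / 2) : |Real.log (1 + s) - s| ≤ 2 * |s| ^ 2 := by
  have h1 := Real.abs_log_sub_add_sum_range_le (x := -s) (by rw [abs_neg]; linarith) 1
  simp only [Finset.sum_range_one, abs_neg, sub_neg_eq_add] at h1
  norm_num at h1
  rw [show Real.log (1 + s) - s = -s + Real.log (1 + s) by ring]
  refine h1.trans ?_
  rw [div_le_iff₀ (by linarith)]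
  nlinarith [sq_abs s, sq_nonneg s]

lemma abs_log_one_add_sub_add_le {a : ℝ} (ha : |a| ≤ 1 / 2) :
    |Real.log (1 + a) - a + a ^ 2 / 2| ≤ 2 * |a| ^ 3 := by
  have h1 := Real.abs_log_sub_add_sum_range_le (x := -a) (by rw [abs_neg]; linarith) 2
  simp only [Finset.sum_range_succ, Finset.sum_range_zero, abs_neg, sub_neg_eq_add] at h1
  norm_num at h1
  rw [show Real.log (1 + a) - a + a ^ 2 / 2 = -a + a ^ 2 / 2 + Real.log (1 + a) by ring]
  refine h1.trans ?_
  rw [div_le_iff₀ (by linarith)]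
  have : 0 ≤ |a| ^ 3 := by positivity
  nlinarith

lemma abs_one_add_mul_log_sub_le {a : ℝ} (ha : |a| ≤ 1 / 2) :
    |(1 + a) * Real.log (1 + a) - a - a ^ 2 / 2| ≤ 4 * |a| ^ 3 := by
  have h1 := abs_log_one_add_sub_add_le ha
  have h2 : (1 + a) * Real.log (1 + a) - a - a ^ 2 / 2 =
      (1 + a) * (Real.log (1 + a) - a + a ^ 2 / 2) - a ^ 3 / 2 := by ring
  rw [h2]
  have h3 := abs_le.1 ha
  have h4 : |1 + a| ≤ 3 / 2 := abs_le.2 ⟨by linarith, by linarith⟩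
  have h5 : |a ^ 3 / 2| = |a| ^ 3 / 2 := by rw [abs_div, abs_pow, abs_two]
  calc _ ≤ |1 + a| * |Real.log (1 + a) - a + a ^ 2 / 2| + |a ^ 3 / 2| := by
        rw [← abs_mul]; exact abs_sub _ _
    _ ≤ 3 / 2 * (2 * |a| ^ 3) + |a| ^ 3 / 2 := by
        rw [h5]
        exact add_le_add (mul_le_mul h4 h1 (abs_nonneg _) (by norm_num)) le_rfl
    _ ≤ _ := by
        have : 0 ≤ |a| ^ 3 := by positivity
        linarith

lemma abs_sum_weight_mul_le {S : Type*} [Fintype S] {π f : S → ℝ} {δ : ℝ} (hπ : ∀ x, 0 ≤ π x)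
    (hπ1 : ∑ x, π x = 1) (hf : ∀ x, |f x| ≤ δ) : |∑ x, π x * f x| ≤ δ := by
  calc _ ≤ ∑ x, π x * δ := by
        refine (Finset.abs_sum_le_sum_abs _ _).trans (Finset.sum_le_sum fun x _ => ?_)
        rw [abs_mul, abs_of_nonneg (hπ x)]
        exact mul_le_mul_of_nonneg_left (hf x) (hπ x)
    _ = δ := by rw [← Finset.sum_mul, hπ1, one_mul]

/-- Expansion of the relative entropy against the logarithm of a correlation. -/
lemma abs_relative_entropy_sub_log_le {S : Type*} [Fintype S] {π a b : S → ℝ} {η θ : ℝ}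
    (hπ : ∀ x, 0 ≤ π x) (hπ1 : ∑ x, π x = 1) (ha0 : ∑ x, π x * a x = 0)
    (hb0 : ∑ x, π x * b x = 0) (hη0 : 0 ≤ η) (hη : η ≤ 1 / 2) (ha : ∀ x, |a x| ≤ η)
    (hb : ∀ x, |b x| ≤ η) (hab : ∀ x, |a x - 2 * b x| ≤ θ) :
    |∑ x, π x * ((1 + a x) * Real.log (1 + a x)) -
      Real.log (∑ x, π x * ((1 + a x) * (1 + b x)))| ≤ 5 * η ^ 3 + η * θ / 2 := by
  set s := ∑ x, π x * (a x * b x) with hs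
  have h1 : ∑ x, π x * ((1 + a x) * (1 + b x)) = 1 + s := by
    have : ∀ x, π x * ((1 + a x) * (1 + b x)) =
        π x + π x * a x + π x * b x + π x * (a x * b x) := fun x => by ring
    simp_rw [this, Finset.sum_add_distrib]
    rw [hπ1, ha0, hb0]
    ring
  have h2 : |s| ≤ η ^ 2 := abs_sum_weight_mul_le hπ hπ1 fun x => by
    rw [abs_mul, sq]
    exact mul_le_mul (ha x) (hb x) (abs_nonneg _) hη0
  have hη2 : η ^ 2 ≤ 1 / 4 := by nlinarith
  have h3 : |Real.log (1 + s) - s| ≤ η ^ 3 := by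
    refine (abs_log_one_add_sub_le (h2.trans (by linarith))).trans ?_
    have h4 : |s| ^ 2 ≤ (η ^ 2) ^ 2 := pow_le_pow_left₀ (abs_nonneg _) h2 2
    have h5 : 0 ≤ η ^ 3 := by positivity
    nlinarith
  have h6 : |∑ x, π x * ((1 + a x) * Real.log (1 + a x) - a x - a x ^ 2 / 2)| ≤ 4 * η ^ 3 :=
    abs_sum_weight_mul_le hπ hπ1 fun x =>
      (abs_one_add_mul_log_sub_le ((ha x).trans hη)).trans
        (mul_le_mul_of_nonneg_left (pow_le_pow_left₀ (abs_nonneg _) (ha x) 3) (by norm_num))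
  have h7 : |∑ x, π x * (a x * (a x - 2 * b x) / 2)| ≤ η * θ / 2 :=
    abs_sum_weight_mul_le hπ hπ1 fun x => by
      rw [abs_div, abs_mul, abs_two]
      have := mul_le_mul (ha x) (hab x) (abs_nonneg _) hη0
      linarith
  -- The linear terms have mean zero, and the quadratic ones combine as `a² / 2 - a b = a (a - 2b) /
  -- 2`.
  have h8 : ∑ x, π x * ((1 + a x) * Real.log (1 + a x)) - Real.log (1 + s) =
      ∑ x, π x * ((1 + a x) * Real.log (1 + a x) - a x - a x ^ 2 / 2) +
      ∑ x, π x * (a x * (a x - 2 * b x) / 2) - (Real.log (1 + s) - s) := by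
    have h9 : ∑ x, π x * ((1 + a x) * Real.log (1 + a x)) =
        ∑ x, π x * ((1 + a x) * Real.log (1 + a x) - a x - a x ^ 2 / 2) +
        ∑ x, π x * (a x * (a x - 2 * b x) / 2) + ∑ x, π x * a x + s := by
      rw [hs, ← Finset.sum_add_distrib, ← Finset.sum_add_distrib, ← Finset.sum_add_distrib]
      exact Finset.sum_congr rfl fun _ _ => by ring
    rw [h9, ha0]
    ring
  rw [h1, h8]
  refine (abs_sub _ _).trans ?_
  have := abs_add_le (∑ x, π x * ((1 + a x) * Real.log (1 + a x) - a x - a x ^ 2 / 2))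
    (∑ x, π x * (a x * (a x - 2 * b x) / 2))
  linarith

namespace IsPerturbation

variable {S : Type*} [Fintype S] [Nonempty S] {c : S → S → ℝ} {B K ε : ℝ} {k ξ : S → S → ℝ}
  {γ p v : S → ℝ} {μ P : ℝ}

lemma abs_entropy_le_of_small (h : IsPerturbation c B K ε k ξ γ p v μ) (hε1 : ε ≤ 1) (hP0 : 0 ≤ P)
    (hP : ∀ (f : S → ℝ) (x y : S), (f x - f y) ^ 2 ≤ P * ∑ u, ∑ v, k u v * (f u - f v) ^ 2)
    {a₁ a₂ : ℝ} (ha₁ : Fintype.card S * B * responseConst (Fintype.card S) P K B = a₁)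
    (ha₂ : Fintype.card S * B * responseConst₂ (Fintype.card S) P K B = a₂)
    (hsmall : a₁ * ε ≤ 1 / 2) :
    |∑ x, γ x * p x * Real.log (p x) - Real.log (∑ x, γ x * p x * v x)| ≤
      (5 * a₁ ^ 3 + a₁ * a₂ / 2) * ε ^ 3 := by
  have hK := h.K_nonneg
  have hB := h.B_pos
  have hε := h.ε_nonneg
  have hZ := h.Z_pos
  have hZle := h.Z_le
  have hp := h.abs_sub_inv_Z_le h.sum_p (h.abs_p_sub_p_le hε1 hP0 hP)
  have hv := h.abs_sub_inv_Z_le h.sum_v (h.abs_v_sub_v_le hε1 hP0 hP)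
  have hg := h.abs_two_mul_v_sub_p_le hε1 hP0 hP
  set Z := ∑ x, γ x with hZdef
  have hC1 : 0 ≤ responseConst (Fintype.card S) P K B := by
    unfold responseConst; positivity
  have hC2 : 0 ≤ responseConst₂ (Fintype.card S) P K B := by
    unfold responseConst₂; positivity
  have hscale : ∀ {f C d : ℝ}, |f - Z⁻¹| ≤ C * d → 0 ≤ C * d →
      |Z * f - 1| ≤ Fintype.card S * B * C * d := by
    intro f C d h1 h2
    have h3 : Z * f - 1 = Z * (f - Z⁻¹) := by field_simp
    rw [h3, abs_mul, abs_of_pos hZ, mul_assoc _ C d]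
    exact mul_le_mul hZle h1 (abs_nonneg _) (hZ.le.trans hZle)
  have ha0 : ∀ f : S → ℝ, ∑ x, γ x * f x = 1 → ∑ x, γ x / Z * (Z * f x - 1) = 0 := by
    intro f hf
    have h1 : ∀ x, γ x / Z * (Z * f x - 1) = γ x * f x - γ x / Z := fun x => by field_simp
    simp_rw [h1, Finset.sum_sub_distrib, hf, ← Finset.sum_div]
    rw [← hZdef, div_self hZ.ne', sub_self]
  have hπ1 : ∑ x, γ x / Z = 1 := by rw [← Finset.sum_div, ← hZdef, div_self hZ.ne']
  have ha₁0 : 0 ≤ a₁ := by rw [← ha₁]; positivity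
  -- Densities are taken relative to the equilibrium distribution `γ / Z`. The factor `Z ≤ n B` is
  -- absorbed in `a₁` and `a₂`, and the resulting `log Z` cancels between the two terms.
  have key := abs_relative_entropy_sub_log_le (π := fun x => γ x / Z) (a := fun x => Z * p x - 1)
    (b := fun x => Z * v x - 1) (η := a₁ * ε) (θ := a₂ * ε ^ 2)
    (fun x => (div_pos (h.γ_pos x) hZ).le) hπ1 (ha0 p h.sum_p) (ha0 v h.sum_v)
    (mul_nonneg ha₁0 hε) hsmall
    (fun x => by rw [← ha₁]; exact hscale (hp x) (mul_nonneg hC1 hε))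
    (fun x => by rw [← ha₁]; exact hscale (hv x) (mul_nonneg hC1 hε))
    (fun x => by
      rw [← ha₂, abs_sub_comm]
      have := hscale (hg x) (mul_nonneg hC2 (sq_nonneg ε))
      rwa [show Z * (2 * v x - p x) - 1 = 2 * (Z * v x - 1) - (Z * p x - 1) by ring] at this)
  simp only [add_sub_cancel] at key
  have e1 : ∑ x, γ x / Z * (Z * p x * Real.log (Z * p x)) =
      Real.log Z + ∑ x, γ x * p x * Real.log (p x) := by
    have h1 : ∀ x, γ x / Z * (Z * p x * Real.log (Z * p x)) =
        γ x * p x * Real.log Z + γ x * p x * Real.log (p x) := fun x => by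
      rw [Real.log_mul hZ.ne' (h.p_pos x).ne']
      field_simp
    simp_rw [h1, Finset.sum_add_distrib, ← Finset.sum_mul]
    rw [h.sum_p, one_mul]
  have hw : 0 < ∑ x, γ x * p x * v x :=
    Finset.sum_pos (fun x _ => mul_pos (mul_pos (h.γ_pos x) (h.p_pos x)) (h.v_pos x))
      Finset.univ_nonempty
  have e2 : ∑ x, γ x / Z * (Z * p x * (Z * v x)) = Z * ∑ x, γ x * p x * v x := by
    rw [Finset.mul_sum]
    exact Finset.sum_congr rfl fun x _ => by field_simp
  rw [e1, e2, Real.log_mul hZ.ne' hw.ne', add_sub_add_left_eq_sub] at key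
  refine key.trans (le_of_eq ?_)
  ring

/-! ### Harnack inequality and the regime of large perturbations -/

omit [Nonempty S] in
lemma sum_exp_le (h : IsPerturbation c B K ε k ξ γ p v μ) (x : S) :
    ∑ y, k x y * Real.exp (ε * ξ x y) ≤ Fintype.card S * K * Real.exp ε := by
  refine (le_abs_self _).trans ((abs_sum_le_card_mul (δ := K * Real.exp ε) fun y => ?_).trans
    (le_of_eq (by ring)))
  rw [abs_of_nonneg (mul_nonneg (h.k_nonneg x y) (Real.exp_pos _).le)]
  exact mul_le_mul (h.k_le x y) (Real.exp_le_exp.2 ((le_abs_self _).trans (h.abs_εξ_le x y)))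
    (Real.exp_pos _).le ((h.k_nonneg x y).trans (h.k_le x y))

omit [Nonempty S] in
-- Since `μ ≤ 0`, the eigenvalue equation bounds the inflow at `x` by the outflow. Keeping a single
-- inflow term compares neighbouring values of `v`, with `e^ε` lost on each side.
lemma conductance_mul_le (h : IsPerturbation c B K ε k ξ γ p v μ) (x y : S) :
    c x y * v y ≤ B * (Fintype.card S * K) * Real.exp (2 * ε) * v x := by
  have h1 : ∑ y, k x y * (v y * Real.exp (ε * (ξ x y + ξ y x) / 2)) ≤
      v x * (Fintype.card S * K * Real.exp ε) := by
    have h2 : ∑ y, k x y * (v y * Real.exp (ε * (ξ x y + ξ y x) / 2)) =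
        μ * (γ x * v x) + v x * ∑ y, k x y * Real.exp (ε * ξ x y) := by
      rw [← h.eig x, Finset.mul_sum, ← Finset.sum_add_distrib]
      exact Finset.sum_congr rfl fun _ _ => by ring
    rw [h2]
    have h3 := mul_nonpos_of_nonpos_of_nonneg h.μ_nonpos (mul_pos (h.γ_pos x) (h.v_pos x)).le
    have h4 := mul_le_mul_of_nonneg_left (h.sum_exp_le x) (h.v_pos x).le
    linarith
  have h5 : k x y * (v y * Real.exp (-ε)) ≤ v x * (Fintype.card S * K * Real.exp ε) := by
    refine le_trans ?_ (le_trans (Finset.single_le_sum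
      (f := fun y => k x y * (v y * Real.exp (ε * (ξ x y + ξ y x) / 2)))
      (fun y _ => mul_nonneg (h.k_nonneg x y) (mul_pos (h.v_pos y) (Real.exp_pos _)).le)
      (Finset.mem_univ y)) h1)
    exact mul_le_mul_of_nonneg_left (mul_le_mul_of_nonneg_left
      (Real.exp_le_exp.2 (abs_le.1 (h.abs_εξ_symm_le x y)).1) (h.v_pos y).le) (h.k_nonneg x y)
  have h6 : c x y * v y ≤ B * k x y * v y :=
    mul_le_mul_of_nonneg_right (h.k_ge x y) (h.v_pos y).le
  have h7 : Real.exp ε * Real.exp (-ε) = 1 := by rw [← Real.exp_add, add_neg_cancel, Real.exp_zero]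
  have h8 : Real.exp (2 * ε) = Real.exp ε * Real.exp ε := by rw [← Real.exp_add]; congr 1; ring
  have h9 := mul_le_mul_of_nonneg_left h5 (mul_pos h.B_pos (Real.exp_pos ε)).le
  calc c x y * v y ≤ B * k x y * v y := h6
    _ = B * Real.exp ε * (k x y * (v y * Real.exp (-ε))) := by
        linear_combination (-(B * k x y * v y)) * h7
    _ ≤ _ := h9
    _ = _ := by rw [h8]; ring

/-- Harnack inequality for the Perron eigenvector. -/
lemma _root_.NESS.exists_harnack {S : Type*} [Fintype S] {c : S → S → ℝ} (hc0 : ∀ x y, 0 ≤ c x y)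
    (hc : ∀ x y, Relation.ReflTransGen (fun u v => c u v ≠ 0) x y) (B K : ℝ) :
    ∃ L : ℝ, 0 ≤ L ∧ ∀ {ε : ℝ} {k ξ : S → S → ℝ} {γ p v : S → ℝ} {μ : ℝ},
      IsPerturbation c B K ε k ξ γ p v μ → ∀ x y, Real.log (v y) ≤ Real.log (v x) + L * (1 + ε) := by
  have key : ∀ x y, ∃ L : ℝ, 0 ≤ L ∧ ∀ {ε : ℝ} {k ξ : S → S → ℝ} {γ p v : S → ℝ} {μ : ℝ},
      IsPerturbation c B K ε k ξ γ p v μ → Real.log (v y) ≤ Real.log (v x) + L * (1 + ε) := by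
    intro x y
    induction hc x y with
    | refl =>
      exact ⟨0, le_rfl, fun h => by simp⟩
    | tail _ huw ih =>
      rename_i u w _
      obtain ⟨L, hL0, hL⟩ := ih
      have hcuw : 0 < c u w := lt_of_le_of_ne (hc0 u w) (Ne.symm huw)
      set D := B * (Fintype.card S * K) / c u w with hD
      -- One more edge costs `log D + 2ε`, which is at most `(|log D| + 2) (1 + ε)`.
      refine ⟨L + (|Real.log D| + 2), by positivity, fun {ε k ξ γ p v μ} h => ?_⟩
      have h1 := h.conductance_mul_le u w
      have h2 : v w ≤ D * (Real.exp (2 * ε) * v u) := by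
        rw [hD, div_mul_eq_mul_div, le_div_iff₀ hcuw]
        linarith
      have hDpos : 0 < D := pos_of_mul_pos_left ((h.v_pos w).trans_le h2)
        (mul_pos (Real.exp_pos _) (h.v_pos u)).le
      have h3 := Real.log_le_log (h.v_pos w) h2
      rw [Real.log_mul hDpos.ne' (mul_pos (Real.exp_pos _) (h.v_pos u)).ne',
        Real.log_mul (Real.exp_pos _).ne' (h.v_pos u).ne', Real.log_exp] at h3
      have h4 := hL h
      have h5 := le_abs_self (Real.log D)
      have h6 : 0 ≤ |Real.log D| * ε := mul_nonneg (abs_nonneg _) h.ε_nonneg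
      have h7 := h.ε_nonneg
      linarith
  choose L hL0 hL using key
  refine ⟨∑ x, ∑ y, L x y, Finset.sum_nonneg fun x _ => Finset.sum_nonneg fun y _ => hL0 x y,
    fun {ε k ξ γ p v μ} h x y => (hL x y h).trans (add_le_add le_rfl
      (mul_le_mul_of_nonneg_right ?_ (by linarith [h.ε_nonneg])))⟩
  exact (Finset.single_le_sum (f := fun y => L x y) (fun y _ => hL0 x y) (Finset.mem_univ y)).trans
    (Finset.single_le_sum (f := fun x => ∑ y, L x y)
      (fun x _ => Finset.sum_nonneg fun y _ => hL0 x y) (Finset.mem_univ x))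

/-- The first sum is bounded because `t log t` is bounded on `(0, 1]` and `log γ` is bounded. The
second is the logarithm of a `ρ`-average of `v`, which lies between the minimum of `v` and `B`; the
maximum of `v` is at least `1 / (n B)` by normalization, and Harnack carries this to the minimum. -/
lemma abs_entropy_le_of_harnack (h : IsPerturbation c B K ε k ξ γ p v μ) {L : ℝ}
    (hL : ∀ x y, Real.log (v y) ≤ Real.log (v x) + L * (1 + ε)) :
    |∑ x, γ x * p x * Real.log (p x) - Real.log (∑ x, γ x * p x * v x)| ≤
      Fintype.card S * (1 + Real.log B) + 2 * Real.log B + Real.log (Fintype.card S) +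
        L * (1 + ε) := by
  have hB := h.B_pos
  have hlogB : 0 ≤ Real.log B := Real.log_nonneg h.B_ge
  have hn : (1 : ℝ) ≤ Fintype.card S := by exact_mod_cast Fintype.card_pos
  have hlogn : 0 ≤ Real.log (Fintype.card S) := Real.log_nonneg hn
  have hρ : ∀ x, 0 < γ x * p x := fun x => mul_pos (h.γ_pos x) (h.p_pos x)
  have h1 : |∑ x, γ x * p x * Real.log (p x)| ≤ Fintype.card S * (1 + Real.log B) := by
    refine abs_sum_le_card_mul fun x => ?_
    have hρ1 := h.γ_mul_le h.p_pos h.sum_p x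
    have h2 := Real.abs_log_mul_self_lt (γ x * p x) (hρ x) hρ1
    have h3 : γ x * p x * Real.log (p x) =
        Real.log (γ x * p x) * (γ x * p x) - γ x * p x * Real.log (γ x) := by
      rw [Real.log_mul (h.γ_pos x).ne' (h.p_pos x).ne']
      ring
    have h4 : |Real.log (γ x)| ≤ Real.log B := by
      rw [abs_le]
      constructor
      · rw [← Real.log_inv]
        refine Real.log_le_log (inv_pos.2 hB) ?_
        rw [inv_le_iff_one_le_mul₀ hB, mul_comm]
        exact h.γ_ge x
      · exact Real.log_le_log (h.γ_pos x) (h.γ_le x)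
    rw [h3]
    refine (abs_sub _ _).trans (add_le_add h2.le ?_)
    rw [abs_mul, abs_of_pos (hρ x)]
    exact (mul_le_of_le_one_left (abs_nonneg _) hρ1).trans h4
  set w := ∑ x, γ x * p x * v x with hw
  have hwB : w ≤ B := by
    calc w ≤ ∑ x, γ x * p x * B := Finset.sum_le_sum fun x _ =>
          mul_le_mul_of_nonneg_left (h.le_B h.v_pos h.sum_v x) (hρ x).le
      _ = B := by rw [← Finset.sum_mul, h.sum_p, one_mul]
  obtain ⟨x₁, hx₁⟩ := Finite.exists_min v
  obtain ⟨y₁, hy₁⟩ := Finite.exists_max v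
  have hwv : v x₁ ≤ w := by
    calc v x₁ = ∑ x, γ x * p x * v x₁ := by rw [← Finset.sum_mul, h.sum_p, one_mul]
      _ ≤ w := Finset.sum_le_sum fun x _ => mul_le_mul_of_nonneg_left (hx₁ x) (hρ x).le
  have hvy : 1 ≤ Fintype.card S * B * v y₁ := by
    calc 1 = ∑ x, γ x * v x := h.sum_v.symm
      _ ≤ ∑ x, γ x * v y₁ := Finset.sum_le_sum fun x _ =>
          mul_le_mul_of_nonneg_left (hy₁ x) (h.γ_pos x).le
      _ = (∑ x, γ x) * v y₁ := by rw [Finset.sum_mul]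
      _ ≤ _ := mul_le_mul_of_nonneg_right h.Z_le (h.v_pos y₁).le
  have h5 : Real.log w ≤ Real.log B := Real.log_le_log ((h.v_pos x₁).trans_le hwv) hwB
  have h6 : Real.log (v x₁) ≤ Real.log w := Real.log_le_log (h.v_pos x₁) hwv
  have h7 := Real.log_le_log one_pos hvy
  rw [Real.log_one, Real.log_mul (mul_pos (by linarith) hB).ne' (h.v_pos y₁).ne',
    Real.log_mul (by linarith) hB.ne'] at h7
  have h8 := hL x₁ y₁
  have hL0 : 0 ≤ L * (1 + ε) := by
    have := hL x₁ x₁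
    linarith
  have h9 : |Real.log w| ≤ 2 * Real.log B + Real.log (Fintype.card S) + L * (1 + ε) :=
    abs_le.2 ⟨by linarith, by linarith⟩
  refine (abs_sub _ _).trans ?_
  linarith

/-- The entropy estimate, uniformly in all perturbations of a given class. -/
theorem _root_.NESS.exists_entropy_bound {c : S → S → ℝ} (hc0 : ∀ x y, 0 ≤ c x y)
    (hc : ∀ x y, Relation.ReflTransGen (fun u v => c u v ≠ 0) x y) {B K : ℝ} (hB : 1 ≤ B)
    (hK : 0 ≤ K) :
    ∃ A : ℝ, 0 < A ∧ ∀ {ε : ℝ} {k ξ : S → S → ℝ} {γ p v : S → ℝ} {μ : ℝ},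
      IsPerturbation c B K ε k ξ γ p v μ →
      |∑ x, γ x * p x * Real.log (p x) - Real.log (∑ x, γ x * p x * v x)| ≤ A * ε ^ 3 := by
  obtain ⟨P, hP0, hP⟩ := exists_poincare hc0 hc
  obtain ⟨L, hL0, hL⟩ := exists_harnack hc0 hc B K
  have hB0 : 0 < B := one_pos.trans_le hB
  have hPB : 0 ≤ P * B := mul_nonneg hP0 hB0.le
  have hC1 : 0 ≤ responseConst (Fintype.card S) (P * B) K B := by
    unfold responseConst; positivity
  have hC2 : 0 ≤ responseConst₂ (Fintype.card S) (P * B) K B := by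
    unfold responseConst₂; positivity
  set a₁ := Fintype.card S * B * responseConst (Fintype.card S) (P * B) K B with ha₁
  set a₂ := Fintype.card S * B * responseConst₂ (Fintype.card S) (P * B) K B with ha₂
  have ha₁0 : 0 ≤ a₁ := by positivity
  have ha₂0 : 0 ≤ a₂ := by positivity
  set T := Fintype.card S * (1 + Real.log B) + 2 * Real.log B + Real.log (Fintype.card S) + L
    with hT
  have hn : (1 : ℝ) ≤ Fintype.card S := by exact_mod_cast Fintype.card_pos
  have hlogB : 0 ≤ Real.log B := Real.log_nonneg hB
  have hlogn : 0 ≤ Real.log (Fintype.card S) := Real.log_nonneg hn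
  have hT0 : 0 < T := by
    have : (1 : ℝ) ≤ Fintype.card S * (1 + Real.log B) := by nlinarith
    linarith
  -- Chosen so that `D * ε ≤ 1` gives both `ε ≤ 1` and `a₁ * ε ≤ 1 / 2`. In the opposite case `1 + ε
  -- ≤ 2 (D ε)³`, so linear growth suffices.
  set D := 1 + 2 * a₁ with hD
  refine ⟨5 * a₁ ^ 3 + a₁ * a₂ / 2 + T * (2 * D ^ 3), by positivity,
    fun {ε k ξ γ p v μ} h => ?_⟩
  have hε := h.ε_nonneg
  by_cases hs : D * ε ≤ 1
  · have hε1 : ε ≤ 1 := by nlinarith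
    -- The Poincaré constant of `c` serves every admissible `k` because `c ≤ B k`.
    have hP' : ∀ (f : S → ℝ) (x y : S),
        (f x - f y) ^ 2 ≤ P * B * ∑ u, ∑ v, k u v * (f u - f v) ^ 2 := by
      intro f x y
      refine (hP f x y).trans ?_
      rw [mul_assoc]
      refine mul_le_mul_of_nonneg_left ?_ hP0
      simp_rw [Finset.mul_sum]
      refine Finset.sum_le_sum fun u _ => Finset.sum_le_sum fun v _ => ?_
      rw [← mul_assoc]
      exact mul_le_mul_of_nonneg_right (h.k_ge u v) (sq_nonneg _)
    refine (h.abs_entropy_le_of_small hε1 hPB hP' ha₁.symm ha₂.symm (by linarith)).trans ?_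
    have : 0 ≤ T * (2 * D ^ 3) * ε ^ 3 := by positivity
    linarith
  · push Not at hs
    have h1 := h.abs_entropy_le_of_harnack (hL h)
    have h2 : Fintype.card S * (1 + Real.log B) + 2 * Real.log B + Real.log (Fintype.card S) +
        L * (1 + ε) ≤ T * (1 + ε) := by
      have : 0 ≤ (Fintype.card S * (1 + Real.log B) + 2 * Real.log B +
        Real.log (Fintype.card S)) * ε := by positivity
      linarith
    have h3 : D * ε ≤ (D * ε) ^ 3 := by
      nlinarith [mul_nonneg (sub_nonneg.2 hs.le) (sub_nonneg.2 hs.le)]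
    have h4 : ε ≤ D * ε := by nlinarith
    have h5 : 1 + ε ≤ 2 * (D * ε) ^ 3 := by linarith
    have h6 := mul_le_mul_of_nonneg_left h5 hT0.le
    have h7 : 0 ≤ (5 * a₁ ^ 3 + a₁ * a₂ / 2) * ε ^ 3 := by positivity
    calc _ ≤ T * (1 + ε) := h1.trans h2
      _ ≤ T * (2 * (D * ε) ^ 3) := h6
      _ ≤ _ := by
        have : T * (2 * (D * ε) ^ 3) = T * (2 * D ^ 3) * ε ^ 3 := by ring
        linarith

end IsPerturbation

/-! ### From rates to the perturbation equations -/

section Conductances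

variable {S : Type*} [Fintype S] [DecidableEq S] {R k ξ : S → S → ℝ} {w : S → ℝ} {ε : ℝ}

/-- The rates `R` come from the symmetric conductances `k`, the Boltzmann weights `w⁻²` and the
nonequilibrium function `ξ`. -/
structure HasConductances (R k ξ : S → S → ℝ) (w : S → ℝ) (ε : ℝ) : Prop where
  k_symm : ∀ x y, k x y = k y x
  k_nonneg : ∀ x y, 0 ≤ k x y
  k_diag : ∀ x, k x x = 0
  w_pos : ∀ x, 0 < w x
  rate_eq : ∀ x y, x ≠ y → R x y = w x ^ 2 * (k x y * Real.exp (ε * ξ x y))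

omit [Fintype S] [DecidableEq S] in
lemma exp_symm_eq (ε : ℝ) (ξ : S → S → ℝ) (x y : S) :
    Real.exp (ε * (ξ x y + ξ y x) / 2) * Real.exp (ε * (ξ x y + ξ y x) / 2) =
      Real.exp (ε * ξ x y) * Real.exp (ε * ξ y x) := by
  rw [← Real.exp_add, ← Real.exp_add]
  congr 1
  ring

lemma HasConductances.symmetrizedRate_eq (h : HasConductances R k ξ w ε) {x y : S} (hxy : x ≠ y) :
    symmetrizedRate R x y =
      w x * w y * (k x y * Real.exp (ε * (ξ x y + ξ y x) / 2)) := by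
  have h1 : 0 ≤ w x * w y * (k x y * Real.exp (ε * (ξ x y + ξ y x) / 2)) :=
    mul_nonneg (mul_pos (h.w_pos x) (h.w_pos y)).le
      (mul_nonneg (h.k_nonneg x y) (Real.exp_pos _).le)
  have h2 : R x y * R y x = w x * w y * (k x y * Real.exp (ε * (ξ x y + ξ y x) / 2)) *
      (w x * w y * (k x y * Real.exp (ε * (ξ x y + ξ y x) / 2))) := by
    rw [h.rate_eq x y hxy, h.rate_eq y x hxy.symm, h.k_symm y x]
    linear_combination (-(w x ^ 2 * w y ^ 2 * k x y ^ 2)) * exp_symm_eq ε ξ x y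
  rw [symmetrizedRate, if_neg hxy, h2, Real.sqrt_mul_self h1]

lemma HasConductances.escapeRate_eq (h : HasConductances R k ξ w ε) (x : S) :
    escapeRate R x = w x ^ 2 * ∑ y, k x y * Real.exp (ε * ξ x y) := by
  rw [escapeRate, Finset.filter_ne', ← Finset.add_sum_erase _ _ (Finset.mem_univ x), h.k_diag,
    zero_mul, zero_add, Finset.mul_sum]
  exact Finset.sum_congr rfl fun y hy => h.rate_eq x y (Finset.ne_of_mem_erase hy).symm

/-- The symmetrized generator in terms of relative densities. -/
lemma HasConductances.sum_symmetrizedRate (h : HasConductances R k ξ w ε) (f : S → ℝ) (x : S) :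
    ∑ y, symmetrizedRate R x y * (f y / w y) = w x *
      ∑ y, k x y * (f y * Real.exp (ε * (ξ x y + ξ y x) / 2) - f x * Real.exp (ε * ξ x y)) := by
  have h0 := fun x => (h.w_pos x).ne'
  have h1 : ∑ y, k x y * (f y * Real.exp (ε * (ξ x y + ξ y x) / 2) - f x * Real.exp (ε * ξ x y)) =
      ∑ y, k x y * (f y * Real.exp (ε * (ξ x y + ξ y x) / 2)) -
        f x * ∑ y, k x y * Real.exp (ε * ξ x y) := by
    rw [Finset.mul_sum, ← Finset.sum_sub_distrib]
    exact Finset.sum_congr rfl fun _ _ => by ring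
  rw [h1, ← Finset.add_sum_erase _ _ (Finset.mem_univ x),
    ← Finset.add_sum_erase _ (fun y => k x y * (f y * _)) (Finset.mem_univ x), h.k_diag,
    symmetrizedRate, if_pos rfl, h.escapeRate_eq, zero_mul, zero_add, mul_sub]
  have h2 : ∑ y ∈ Finset.univ.erase x, symmetrizedRate R x y * (f y / w y) =
      ∑ y ∈ Finset.univ.erase x, w x * (k x y * (f y * Real.exp (ε * (ξ x y + ξ y x) / 2))) := by
    refine Finset.sum_congr rfl fun y hy => ?_
    rw [h.symmetrizedRate_eq (Finset.ne_of_mem_erase hy).symm]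
    have := h0 y
    field_simp
  rw [h2, ← Finset.mul_sum]
  generalize ∑ y, k x y * Real.exp (ε * ξ x y) = a
  have := h0 x
  field_simp
  ring

lemma HasConductances.sum_rateMatrix (h : HasConductances R k ξ w ε) (p : S → ℝ) (x : S) :
    ∑ y, rateMatrix R x y * (p y / w y ^ 2) =
      ∑ y, k x y * (p y * Real.exp (ε * ξ y x) - p x * Real.exp (ε * ξ x y)) := by
  have h0 := fun x => (h.w_pos x).ne'
  have h1 : ∑ y, k x y * (p y * Real.exp (ε * ξ y x) - p x * Real.exp (ε * ξ x y)) =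
      ∑ y, k x y * (p y * Real.exp (ε * ξ y x)) - p x * ∑ y, k x y * Real.exp (ε * ξ x y) := by
    rw [Finset.mul_sum, ← Finset.sum_sub_distrib]
    exact Finset.sum_congr rfl fun _ _ => by ring
  rw [h1, sum_rateMatrix_mul,
    ← Finset.add_sum_erase _ (fun y => k x y * (p y * _)) (Finset.mem_univ x), h.k_diag,
    h.escapeRate_eq, zero_mul, zero_add]
  have h2 : ∑ y ∈ Finset.univ.erase x, R y x * (p y / w y ^ 2) =
      ∑ y ∈ Finset.univ.erase x, k x y * (p y * Real.exp (ε * ξ y x)) := by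
    refine Finset.sum_congr rfl fun y hy => ?_
    rw [h.rate_eq y x (Finset.ne_of_mem_erase hy), h.k_symm y x]
    have := h0 y
    field_simp
  rw [h2]
  have := h0 x
  field_simp
  ring

omit [DecidableEq S] in
-- By the symmetry of `k` the form is minus half the sum of `k x y` times the squares of `f x e^{ε ξ
-- x y / 2} - f y e^{ε ξ y x / 2}`. This is the source of `μ ≤ 0`.
lemma HasConductances.quadratic_nonpos (h : HasConductances R k ξ w ε) (f : S → ℝ) :
    ∑ x, f x * ∑ y, k x y *
      (f y * Real.exp (ε * (ξ x y + ξ y x) / 2) - f x * Real.exp (ε * ξ x y)) ≤ 0 := by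
  have h2 : ∑ x, ∑ y, k x y * (f x ^ 2 * Real.exp (ε * ξ x y)) =
      ∑ x, ∑ y, k x y * (f y ^ 2 * Real.exp (ε * ξ y x)) := by
    rw [Finset.sum_comm]
    exact Finset.sum_congr rfl fun _ _ => Finset.sum_congr rfl fun _ _ => by rw [h.k_symm]
  have h3 : ∑ x, f x * ∑ y, k x y *
      (f y * Real.exp (ε * (ξ x y + ξ y x) / 2) - f x * Real.exp (ε * ξ x y)) =
      ∑ x, ∑ y, k x y * (f x * f y * Real.exp (ε * (ξ x y + ξ y x) / 2)) -
        ∑ x, ∑ y, k x y * (f x ^ 2 * Real.exp (ε * ξ x y)) := by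
    simp_rw [Finset.mul_sum, ← Finset.sum_sub_distrib]
    exact Finset.sum_congr rfl fun _ _ => Finset.sum_congr rfl fun _ _ => by ring
  have h4 : 0 ≤ ∑ x, ∑ y, k x y *
      (f x * Real.exp (ε * ξ x y / 2) - f y * Real.exp (ε * ξ y x / 2)) ^ 2 :=
    Finset.sum_nonneg fun x _ => Finset.sum_nonneg fun y _ =>
      mul_nonneg (h.k_nonneg x y) (sq_nonneg _)
  have h5 : ∑ x, ∑ y, k x y *
      (f x * Real.exp (ε * ξ x y / 2) - f y * Real.exp (ε * ξ y x / 2)) ^ 2 =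
      ∑ x, ∑ y, k x y * (f x ^ 2 * Real.exp (ε * ξ x y)) +
      ∑ x, ∑ y, k x y * (f y ^ 2 * Real.exp (ε * ξ y x)) -
      2 * ∑ x, ∑ y, k x y * (f x * f y * Real.exp (ε * (ξ x y + ξ y x) / 2)) := by
    simp_rw [Finset.mul_sum, ← Finset.sum_add_distrib, ← Finset.sum_sub_distrib]
    refine Finset.sum_congr rfl fun x _ => Finset.sum_congr rfl fun y _ => ?_
    have e1 : Real.exp (ε * ξ x y) = Real.exp (ε * ξ x y / 2) * Real.exp (ε * ξ x y / 2) := by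
      rw [← Real.exp_add]; congr 1; ring
    have e2 : Real.exp (ε * ξ y x) = Real.exp (ε * ξ y x / 2) * Real.exp (ε * ξ y x / 2) := by
      rw [← Real.exp_add]; congr 1; ring
    have e3 : Real.exp (ε * (ξ x y + ξ y x) / 2) =
        Real.exp (ε * ξ x y / 2) * Real.exp (ε * ξ y x / 2) := by
      rw [← Real.exp_add]; congr 1; ring
    rw [e1, e2, e3]
    ring
  rw [h3]
  linarith

/-- The relative densities of the stationary distribution and of the Perron eigenvector satisfy
the perturbation equations. -/
lemma HasConductances.isPerturbation [Nonempty S] (h : HasConductances R k ξ w ε)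
    {c : S → S → ℝ} {B K : ℝ} (hB : 1 ≤ B) (hε : 0 ≤ ε) (hk_ge : ∀ x y, c x y ≤ B * k x y)
    (hk_le : ∀ x y, k x y ≤ K) (hξ : ∀ x y, |ξ x y| ≤ 1) (hw_le : ∀ x, w x ^ 2 ≤ B)
    (hw_ge : ∀ x, 1 ≤ B * w x ^ 2) {ρ : S → ℝ} (hρ0 : ∀ x, 0 < ρ x)
    (hρ : IsStationaryDistribution R ρ) {e : S → S → ℝ} {μ : S → ℝ} {i₀ : S}
    (he : IsEigenbasis (symmetrizedRate R) e μ) (hi : ∀ i, i ≠ i₀ → μ i < μ i₀)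
    (hpos : ∀ x, 0 < e i₀ x) :
    IsPerturbation c B K ε k ξ (fun x => (w x ^ 2)⁻¹) (fun x => ρ x * w x ^ 2)
      (fun x => e i₀ x * w x / ∑ y, e i₀ y / w y) (μ i₀) := by
  have hw0 := fun x => (h.w_pos x).ne'
  have hN : 0 < ∑ y, e i₀ y / w y :=
    Finset.sum_pos (fun y _ => div_pos (hpos y) (h.w_pos y)) Finset.univ_nonempty
  set N := ∑ y, e i₀ y / w y with hNdef
  set v : S → ℝ := fun x => e i₀ x * w x / N with hv
  have hv0 : ∀ x, 0 < v x := fun x => div_pos (mul_pos (hpos x) (h.w_pos x)) hN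
  have heig : ∀ x, ∑ y, k x y * (v y * Real.exp (ε * (ξ x y + ξ y x) / 2) -
      v x * Real.exp (ε * ξ x y)) = μ i₀ * ((w x ^ 2)⁻¹ * v x) := by
    intro x
    have h1 := h.sum_symmetrizedRate v x
    have h2 : ∑ y, symmetrizedRate R x y * (v y / w y) = μ i₀ * e i₀ x / N := by
      rw [← he.eigen i₀ x, Finset.sum_div]
      refine Finset.sum_congr rfl fun y _ => ?_
      have := hw0 y
      simp only [hv]
      field_simp
    rw [h2] at h1
    have := hw0 x
    refine mul_left_cancel₀ this (h1.symm.trans ?_)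
    simp only [hv]
    field_simp
  have hμ : ∀ i, μ i ≤ μ i₀ := fun i => by
    by_cases hii : i = i₀
    · rw [hii]
    · exact (hi i hii).le
  refine ⟨hB, hε, h.k_symm, h.k_nonneg, hk_ge, hk_le, hξ, fun x => ?_, fun x => ?_,
    fun x => mul_pos (hρ0 x) (pow_pos (h.w_pos x) 2), hv0, ?_, ?_, fun x => ?_, heig, ?_, ?_⟩
  · rw [← div_eq_mul_inv, one_le_div (pow_pos (h.w_pos x) 2)]
    exact hw_le x
  · rw [inv_le_iff_one_le_mul₀ (pow_pos (h.w_pos x) 2)]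
    exact hw_ge x
  · rw [← hρ.2.1]
    refine Finset.sum_congr rfl fun x _ => ?_
    have := hw0 x
    field_simp
  · rw [← div_self hN.ne', hNdef, Finset.sum_div]
    refine Finset.sum_congr rfl fun x _ => ?_
    have := hw0 x
    simp only [hv, hNdef]
    field_simp
  · rw [← h.sum_rateMatrix]
    have := (rateMatrix_mulVec_eq_zero_iff R ρ).1 hρ.2.2 x
    simp_rw [mul_div_cancel_right₀ _ (pow_ne_zero 2 (hw0 _))]
    exact this
  -- The eigenvalue equation is tested against `v` itself.
  · have h1 := h.quadratic_nonpos v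
    simp_rw [heig] at h1
    have h2 : ∑ x, v x * (μ i₀ * ((w x ^ 2)⁻¹ * v x)) = μ i₀ * ∑ x, v x * ((w x ^ 2)⁻¹ * v x) := by
      rw [Finset.mul_sum]
      exact Finset.sum_congr rfl fun _ _ => by ring
    rw [h2] at h1
    refine nonpos_of_mul_nonpos_left h1 (Finset.sum_pos (fun x _ => ?_) Finset.univ_nonempty)
    exact mul_pos (hv0 x) (mul_pos (inv_pos.2 (pow_pos (h.w_pos x) 2)) (hv0 x))
  -- The trial vector `1 / w` is the one with constant relative density; its squared norm is `∑ γ`.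
  · have h1 := he.quadratic_le hμ fun x => 1 / w x
    simp_rw [h.sum_symmetrizedRate fun _ => 1] at h1
    refine le_trans (le_of_eq (Finset.sum_congr rfl fun x _ => ?_)) (h1.trans (le_of_eq ?_))
    · rw [← mul_assoc, one_div_mul_cancel (hw0 x), one_mul]
      exact Finset.sum_congr rfl fun _ _ => by rw [one_mul, one_mul]
    · congr 1
      exact Finset.sum_congr rfl fun x _ => by rw [one_div, inv_pow]

end Conductances

/-! ### Models of the class and the entropy difference -/

section Models

variable {S : Type*}

/-- The factor by which the equilibrium conductance `e^{-β H_x} R_{x → y}` differs from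
`c(x,y)`. -/
def conductanceFactor (rule : RateRule) (β : ℝ) (H : S → ℝ) (x y : S) : ℝ :=
  match rule with
  | RateRule.exponential => 1
  | RateRule.symmetric => Real.exp (-(β / 2 * (H x + H y)))

/-- Detailed balance for both rules: dividing out `e^{βH_x}` leaves `c` times a factor symmetric in
the two states. -/
lemma eqRate_eq (rule : RateRule) (c : S → S → ℝ) (β : ℝ) (H : S → ℝ) (x y : S) :
    eqRate rule c β H x y =
      Real.exp (β * H x / 2) ^ 2 * (c x y * conductanceFactor rule β H x y) := by
  have h1 : Real.exp (β * H x / 2) ^ 2 = Real.exp (β * H x) := by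
    rw [← Real.exp_nat_mul]; congr 1; push_cast; ring
  rw [h1]
  cases rule
  · simp only [eqRate, conductanceFactor]; ring
  · simp only [eqRate, conductanceFactor]
    rw [mul_left_comm, ← Real.exp_add]
    congr 2
    ring

lemma conductanceFactor_symm (rule : RateRule) (β : ℝ) (H : S → ℝ) (x y : S) :
    conductanceFactor rule β H x y = conductanceFactor rule β H y x := by
  cases rule
  · rfl
  · simp only [conductanceFactor, add_comm]

lemma conductanceFactor_le (rule : RateRule) {β E : ℝ} (hβ : 0 < β) (hE : 0 < E) {H : S → ℝ}
    (hH : ∀ x, |H x| ≤ E) (x y : S) : conductanceFactor rule β H x y ≤ Real.exp (β * E) := by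
  cases rule
  · exact Real.one_le_exp (mul_pos hβ hE).le
  · refine Real.exp_le_exp.2 ?_
    nlinarith [(abs_le.1 (hH x)).1, (abs_le.1 (hH y)).1]

lemma one_le_conductanceFactor (rule : RateRule) {β E : ℝ} (hβ : 0 < β) (hE : 0 < E) {H : S → ℝ}
    (hH : ∀ x, |H x| ≤ E) (x y : S) : 1 ≤ Real.exp (β * E) * conductanceFactor rule β H x y := by
  cases rule
  · simpa [conductanceFactor] using (mul_pos hβ hE).le
  · simp only [conductanceFactor]
    rw [← Real.exp_add]
    refine Real.one_le_exp ?_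
    nlinarith [(abs_le.1 (hH x)).2, (abs_le.1 (hH y)).2]

variable {C : ModelClass S}

lemma conductanceFactor_pos (rule : RateRule) (β : ℝ) (H : S → ℝ) (x y : S) :
    0 < conductanceFactor rule β H x y := by
  cases rule
  · exact one_pos
  · exact Real.exp_pos _

lemma Model.rate_ne_zero_iff (M : Model C) (ε : ℝ) (ν : EuclideanSpace ℝ (Fin M.dimν))
    (κ : EuclideanSpace ℝ (Fin M.dimκ)) (x y : S) : M.rate ε ν κ x y ≠ 0 ↔ C.c x y ≠ 0 := by
  rw [Model.rate, eqRate_eq]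
  simp [(conductanceFactor_pos M.rule C.β (M.H ν) x y).ne', Real.exp_ne_zero]

lemma Model.isReversibleSupport (M : Model C) (ε : ℝ) (ν : EuclideanSpace ℝ (Fin M.dimν))
    (κ : EuclideanSpace ℝ (Fin M.dimκ)) : IsReversibleSupport (M.rate ε ν κ) where
  nonneg x y h := by
    rw [Model.rate, eqRate_eq]
    exact mul_nonneg (Real.exp_pos _).le (mul_nonneg (sq_nonneg _)
      (mul_nonneg (C.c_nonneg x y h) (conductanceFactor_pos _ _ _ _ _).le))
  symm x y h h0 := by
    rw [M.rate_ne_zero_iff] at h0 ⊢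
    rwa [← C.c_symm x y h]
  connected x y := by
    simp_rw [M.rate_ne_zero_iff]
    exact C.connected x y

/-- The connectivity with the irrelevant diagonal values set to zero. -/
def ModelClass.offDiag [DecidableEq S] (C : ModelClass S) (x y : S) : ℝ :=
  if x = y then 0 else C.c x y

lemma ModelClass.offDiag_nonneg [DecidableEq S] (C : ModelClass S) (x y : S) :
    0 ≤ C.offDiag x y := by
  unfold ModelClass.offDiag
  split_ifs with h
  · exact le_rfl
  · exact C.c_nonneg x y h

lemma ModelClass.offDiag_connected [DecidableEq S] (C : ModelClass S) (x y : S) :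
    Relation.ReflTransGen (fun u v => C.offDiag u v ≠ 0) x y := by
  refine Relation.ReflTransGen.mono (fun u v h => ?_) x y (C.connected x y)
  rw [ModelClass.offDiag, if_neg h.1]
  exact h.2

lemma ModelClass.offDiag_symm [DecidableEq S] (C : ModelClass S) (x y : S) :
    C.offDiag x y = C.offDiag y x := by
  by_cases h : x = y
  · rw [h]
  · rw [ModelClass.offDiag, ModelClass.offDiag, if_neg h, if_neg (Ne.symm h), C.c_symm x y h]

/-- The nonequilibrium function, set to zero where no jumps are possible. -/
def Model.effectiveXi [DecidableEq S] (M : Model C) (κ : EuclideanSpace ℝ (Fin M.dimκ))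
    (x y : S) : ℝ :=
  if C.offDiag x y = 0 then 0 else M.ξ κ x y

lemma Model.abs_effectiveXi_le [DecidableEq S] (M : Model C) {κ : EuclideanSpace ℝ (Fin M.dimκ)}
    (hκ : κ ∈ M.K) (x y : S) : |M.effectiveXi κ x y| ≤ 1 := by
  unfold Model.effectiveXi
  split_ifs with h
  · simp
  · have hxy : x ≠ y := fun hxy => h (if_pos hxy)
    rw [ModelClass.offDiag, if_neg hxy] at h
    exact M.ξ_bound κ hκ x y hxy h

/-- Where the conductance vanishes the rate is zero whatever `ξ` is, so `effectiveXi` gives the same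
rates while being bounded on all pairs. -/
lemma Model.hasConductances [DecidableEq S] (M : Model C) (ε : ℝ) (ν : EuclideanSpace ℝ (Fin M.dimν))
    (κ : EuclideanSpace ℝ (Fin M.dimκ)) :
    HasConductances (M.rate ε ν κ)
      (fun x y => C.offDiag x y * conductanceFactor M.rule C.β (M.H ν) x y) (M.effectiveXi κ)
      (fun x => Real.exp (C.β * M.H ν x / 2)) ε where
  k_symm x y := by rw [C.offDiag_symm, conductanceFactor_symm]
  k_nonneg x y := mul_nonneg (C.offDiag_nonneg x y) (conductanceFactor_pos _ _ _ _ _).le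
  k_diag x := by rw [ModelClass.offDiag, if_pos rfl, zero_mul]
  w_pos x := Real.exp_pos _
  rate_eq x y h := by
    rw [Model.rate, eqRate_eq, Model.effectiveXi]
    have h1 : C.c x y = C.offDiag x y := (if_neg h).symm
    rw [h1]
    split_ifs with h0
    · simp [h0]
    · ring

/-- The energy joins `log ρ` to form the logarithm of the density relative to `e^{-βH}`, and
`e^{βF}` is the `ρ`-average of the normalized eigenvector density. -/
lemma noneqEntropy_sub_shannonEntropy_eq [Fintype S] {β F : ℝ} {H ρ e : S → ℝ}
    (hρ : ∀ x, 0 < ρ x)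
    (hF : Real.exp (-(β * F)) = (∑ y, e y / Real.exp (β * H y / 2)) /
      ∑ y, ρ y * (Real.exp (β * H y / 2) * e y)) :
    noneqEntropy β H ρ F - shannonEntropy ρ =
      ∑ x, (Real.exp (β * H x / 2) ^ 2)⁻¹ * (ρ x * Real.exp (β * H x / 2) ^ 2) *
          Real.log (ρ x * Real.exp (β * H x / 2) ^ 2) -
        Real.log (∑ x, (Real.exp (β * H x / 2) ^ 2)⁻¹ * (ρ x * Real.exp (β * H x / 2) ^ 2) *
          (e x * Real.exp (β * H x / 2) / ∑ y, e y / Real.exp (β * H y / 2))) := by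
  have h1 : ∀ x, (Real.exp (β * H x / 2) ^ 2)⁻¹ * (ρ x * Real.exp (β * H x / 2) ^ 2) = ρ x :=
    fun x => by field_simp
  have h2 : ∀ x, Real.log (ρ x * Real.exp (β * H x / 2) ^ 2) = Real.log (ρ x) + β * H x := by
    intro x
    rw [Real.log_mul (hρ x).ne' (pow_ne_zero 2 (Real.exp_ne_zero _)), Real.log_pow, Real.log_exp]
    push_cast
    ring
  have h3 : ∑ x, ρ x * (e x * Real.exp (β * H x / 2) / ∑ y, e y / Real.exp (β * H y / 2)) =
      (Real.exp (-(β * F)))⁻¹ := by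
    rw [hF, inv_div, Finset.sum_div]
    exact Finset.sum_congr rfl fun _ _ => by ring
  simp_rw [h1, h2]
  rw [h3, ← Real.exp_neg, Real.log_exp, noneqEntropy, shannonEntropy, steadyExpectation, mul_sub,
    Finset.mul_sum]
  simp_rw [mul_add, Finset.sum_add_distrib]
  have h4 : ∑ x, β * (H x * ρ x) = ∑ x, ρ x * (β * H x) :=
    Finset.sum_congr rfl fun _ _ => by ring
  rw [h4]
  ring

end Models

end

end NESS

/-! ### The main theorem -/

theorem mainTheorem3 {S : Type*} [Fintype S] [DecidableEq S] [Nonempty S]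
    (C : NESS.ModelClass S) :
    ∃ A : ℝ, 0 < A ∧
      ∀ (M : NESS.Model C) (ε : ℝ) (ν : EuclideanSpace ℝ (Fin M.dimν))
        (κ : EuclideanSpace ℝ (Fin M.dimκ)), 0 ≤ ε → ν ∈ M.N → κ ∈ M.K →
        (∃! ρ : S → ℝ, NESS.IsStationaryDistribution (M.rate ε ν κ) ρ) ∧
        ∀ ρ : S → ℝ, NESS.IsStationaryDistribution (M.rate ε ν κ) ρ →
          (∃! F : ℝ, NESS.IsFreeEnergy (M.rate ε ν κ) ρ C.β (M.H ν) F) ∧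
          ∀ F : ℝ, NESS.IsFreeEnergy (M.rate ε ν κ) ρ C.β (M.H ν) F →
            |NESS.noneqEntropy C.β (M.H ν) ρ F - NESS.shannonEntropy ρ| ≤ A * ε ^ 3 := by
  have hβ := C.β_pos
  have hB : 1 ≤ Real.exp (C.β * C.Ebar) := Real.one_le_exp (mul_pos C.β_pos C.Ebar_pos).le
  have hc_le : ∀ x y, C.offDiag x y ≤ ∑ x, ∑ y, C.offDiag x y := fun x y =>
    (Finset.single_le_sum (f := fun y => C.offDiag x y) (fun y _ => C.offDiag_nonneg x y)
      (Finset.mem_univ y)).trans (Finset.single_le_sum (f := fun x => ∑ y, C.offDiag x y)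
        (fun x _ => Finset.sum_nonneg fun y _ => C.offDiag_nonneg x y) (Finset.mem_univ x))
  have hc0 : 0 ≤ ∑ x, ∑ y, C.offDiag x y :=
    Finset.sum_nonneg fun x _ => Finset.sum_nonneg fun y _ => C.offDiag_nonneg x y
  -- Here `B = e^{β Ebar}` controls the Boltzmann weights and conductance factors from both sides,
  -- and `K` is `B` times the total connectivity. Both are fixed before the model is chosen, so `A`
  -- depends on the class only.
  obtain ⟨A, hA0, hA⟩ := NESS.exists_entropy_bound (c := C.offDiag) C.offDiag_nonneg
    C.offDiag_connected hB (mul_nonneg hc0 (Real.exp_pos (C.β * C.Ebar)).le)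
  refine ⟨A, hA0, fun M ε ν κ hε hν hκ => ?_⟩
  have hR := M.isReversibleSupport ε ν κ
  refine ⟨hR.existsUnique_stationary, fun ρ hρ => ?_⟩
  obtain ⟨e, μ, i₀, he, hi, hpos⟩ := NESS.exists_perron_eigenbasis
    (NESS.symmetrizedRate_symm (M.rate ε ν κ)) (NESS.symmetrizedRate_nonneg _)
    hR.symmetrizedRate_connected
  have hlim := hR.tendsto_freeEnergy C.β (M.H ν) he hi hpos hρ.1 hρ.2.1
  have hρ0 := hR.stationary_pos hρ
  have hL : 0 < (∑ y, e i₀ y / Real.exp (C.β * M.H ν y / 2)) /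
      ∑ y, ρ y * (Real.exp (C.β * M.H ν y / 2) * e i₀ y) :=
    div_pos (Finset.sum_pos (fun y _ => div_pos (hpos y) (Real.exp_pos _)) Finset.univ_nonempty)
      (Finset.sum_pos (fun y _ => mul_pos (hρ0 y) (mul_pos (Real.exp_pos _) (hpos y)))
        Finset.univ_nonempty)
  -- The limit is one positive number for all `x`, so being the free energy amounts to a single
  -- equation for `e^{-βF}`, which has exactly one solution.
  have hF : ∀ F, NESS.IsFreeEnergy (M.rate ε ν κ) ρ C.β (M.H ν) F ↔
      Real.exp (-(C.β * F)) = (∑ y, e i₀ y / Real.exp (C.β * M.H ν y / 2)) /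
        ∑ y, ρ y * (Real.exp (C.β * M.H ν y / 2) * e i₀ y) := by
    intro F
    constructor
    · intro h
      obtain ⟨x⟩ := ‹Nonempty S›
      exact tendsto_nhds_unique (h x) (hlim x)
    · intro h x
      rw [h]
      exact hlim x
  refine ⟨⟨-Real.log ((∑ y, e i₀ y / Real.exp (C.β * M.H ν y / 2)) /
      ∑ y, ρ y * (Real.exp (C.β * M.H ν y / 2) * e i₀ y)) / C.β, ?_, fun F h => ?_⟩,
    fun F h => ?_⟩
  · simp only [hF]
    rw [mul_div_cancel₀ _ hβ.ne', neg_neg, Real.exp_log hL]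
  · have h := (hF F).1 h
    rw [← h, Real.log_exp, neg_neg, mul_div_cancel_left₀ _ hβ.ne']
  · rw [hF] at h
    rw [NESS.noneqEntropy_sub_shannonEntropy_eq hρ0 h]
    have hw : ∀ x, Real.exp (C.β * M.H ν x / 2) ^ 2 = Real.exp (C.β * M.H ν x) := fun x => by
      rw [← Real.exp_nat_mul]; congr 1; push_cast; ring
    have hH := M.H_bound ν hν
    refine hA ((M.hasConductances ε ν κ).isPerturbation hB hε (fun x y => ?_) (fun x y => ?_)
      (M.abs_effectiveXi_le hκ) (fun x => ?_) (fun x => ?_) hρ0 hρ he hi hpos)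
    · have h1 := mul_le_mul_of_nonneg_left
        (NESS.one_le_conductanceFactor M.rule hβ C.Ebar_pos hH x y) (C.offDiag_nonneg x y)
      linarith
    · exact mul_le_mul (hc_le x y) (NESS.conductanceFactor_le M.rule hβ C.Ebar_pos hH x y)
        (NESS.conductanceFactor_pos _ _ _ _ _).le hc0
    · rw [hw]
      exact Real.exp_le_exp.2 (mul_le_mul_of_nonneg_left ((le_abs_self _).trans (hH x)) hβ.le)
    · rw [hw, ← Real.exp_add]
      refine Real.one_le_exp ?_
      have := mul_le_mul_of_nonneg_left (abs_le.1 (hH x)).1 hβ.le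
      linarith
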